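/- Let $\mathbb K$ be a Hausdorff commutative unital topological ring whose unit group $\mathbb K^\times$ is open and dense in $\mathbb K$ and has continuous inversion (no assumption on the characteristic). Let $V',V,W$ be topological $\mathbb K$-modules, with $V$ and $W$ Hausdorff, let $U\subset V$ and $U'\subset V'$ be open, and let $k\in\mathbb N$. Definitions. For a map $f:U\to W$ put $U^{[1]}=\{(x,v,t)\in V\times V\times\mathbb K: x\in U,\ x+tv\in U\}$. The map $f$ is of class $C^{[0]}$ if it is continuous, and of class $C^{[k+1]}$ if it is continuous and there is a continuous map $f^{[1]}:U^{[1]}\to W$ of class $C^{[k]}$ with $f^{[1]}(x,v,t)=t^{-1}(f(x+tv)-f(x))$ for all $(x,v,t)\in U^{[1]}$ with $t\in\mathbb K^\times$. With $s_0:=0$, for $\ell\in\mathbb N$ and $i=0,\dots,\ell$ let $p_i(\mathbf v;\mathbf s)=v_0+\sum_{j=1}^{i}\prod_{m=0}^{j-1}(s_i-s_m)\,v_j$, and let $U^{\langle\ell\rangle}$ be the set of $(v_0,\dots,v_\ell;s_1,\dots,s_\ell)\in V^{\ell+1}\times\mathbb K^\ell$ with $p_i(\mathbf v;\mathbf s)\in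 U$ for all $i$. If $f$ is of class $C^{[k]}$ then, for $\ell\le k$, $f^{\langle\ell\rangle}:U^{\langle\ell\rangle}\to W$ is the unique continuous map with $f^{\langle\ell\rangle}(\mathbf v;\mathbf s)=\sum_{i=0}^{\ell}\prod_{j\ne i}(s_i-s_j)^{-1}f(p_i(\mathbf v;\mathbf s))$ whenever all $s_i-s_j$ $(i\neq j)$ are invertible. The simplicial $k$-jet $J^k_xf$ of $f$ at $x\in U$ is the map $(v_1,\dots,v_k)\mapsto\bigl(f^{\langle\ell\rangle}(x,v_1,\dots,v_\ell;\mathbf 0)\bigr)_{\ell=0,\dots,k}$ on $V^k$, and the Taylor polynomial without constant term is $\mathrm{Tay}^k_xf:V\to W$, $h\mapsto\sum_{i=1}^k f^{\langle i\rangle}(x,h,0,\dots,0;\mathbf 0)$. A map $p:V\to W$ is homogeneous polynomial of degree $d$ if for every generating system $(e_i)_{i\in I}$ of $V$ there are $a_\alpha\in W$ with $p(\sum_i t_ie_i)=\sum_{|\alpha|=d}t^\alpha a_\alpha$ for all finitely supported $(t_i)\in\mathbb K^{(I)}$; a polynomial map is a finite sum of such maps. For a polynomial map $P$ with $P(0)=0$,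 written $P(\sum_i t_ie_i)=\sum_{\alpha\ne0}t^\alpha a_\alpha$ (with the degrees $|\alpha|$ bounded), its scalar extension to a commutative, possibly non-unital, $\mathbb K$-algebra $\mathbb A$ is the map $P_{\mathbb A}:V\otimes\mathbb A\to W\otimes\mathbb A$ with $P_{\mathbb A}(\sum_i e_i\otimes c_i)=\sum_{\alpha}a_\alpha\otimes c^\alpha$, for every generating system and every such expression of $P$. Let $J^k_0\mathbb K=\delta\mathbb K\oplus\dots\oplus\delta^k\mathbb K$ be the kernel of $[P]\mapsto P(0)$ on $J^k\mathbb K=\mathbb K[X]/(X^{k+1})$, where $\delta=[X]$. Theorem. Let $f,g:U\to W$ and $h:U'\to V$ be of class $C^{[k]}$ with $h(U')\subset U$. Then: (i) If $x\in U$ and $f(x)=g(x)$, then $\mathrm{Tay}^k_xf=\mathrm{Tay}^k_xg$ if and only if $J^k_xf=J^k_xg$. (ii) For $x\in U$, $\mathrm{Tay}^k_xf$ is a polynomial map without constant term, and $J^k_xf$, without its component of index $0$, is its scalar extension to $J^k_0\mathbb K$: under the identifications $V^k\cong V\otimes J^k_0\mathbb K$, $W^k\cong W\otimes J^k_0\mathbb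 K$, $(v_1,\dots,v_k)\mapsto\sum_{i=1}^k v_i\otimes\delta^i$, one has $J^k_xf=(\mathrm{Tay}^k_xf)_{J^k_0\mathbb K}$. (iii) $g\circ h$ is of class $C^{[k]}$ on $U'$ and, for $x\in U'$, $\mathrm{Tay}^k_x(g\circ h)=\bigl[\mathrm{Tay}^k_{h(x)}g\circ\mathrm{Tay}^k_xh\bigr]\bmod(\deg>k)$; that is, $\mathrm{Tay}^k_{h(x)}g\circ\mathrm{Tay}^k_xh$ is a polynomial map, and $\mathrm{Tay}^k_x(g\circ h)$ is the sum of its homogeneous components of degree at most $k$. -/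

import Mathlib

open scoped TensorProduct Polynomial

universe u v w v'

noncomputable section

namespace WeilJet

/-! ### Cubic differential calculus -/

section Cubic

variable (K : Type u) [CommRing K]

/-- The extended domain `U^[1] = {(x, v, t) | x ∈ U, x + t v ∈ U}`. -/
def cubicDomain {V : Type v} [AddCommGroup V] [Module K V] (U : Set V) : Set (V × V × K) :=
  {p | p.1 ∈ U ∧ p.1 + p.2.2 • p.2.1 ∈ U}

/-- `F` plays the role of `f^[1]`: it is continuous on `U^[1]` and, for invertible `t`,
it is the difference quotient `t⁻¹ (f (x + t v) - f x)`. -/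
def IsDifferenceQuotient [TopologicalSpace K]
    {V : Type v} [AddCommGroup V] [Module K V] [TopologicalSpace V]
    {W : Type w} [AddCommGroup W] [Module K W] [TopologicalSpace W]
    (U : Set V) (f : V → W) (F : V × V × K → W) : Prop :=
  ContinuousOn F (cubicDomain K U) ∧
    ∀ (x v : V) (t : Kˣ), (x, v, (t : K)) ∈ cubicDomain K U →
      F (x, v, (t : K)) = ((t⁻¹ : Kˣ) : K) • (f (x + (t : K) • v) - f x)

/-- `f` is of class `C^[k]` on `U`: there is a chain `f = f^[0], f^[1], …, f^[k]` of continuous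
maps, where `f^[j+1] = (f^[j])^[1]` extends the difference quotient of `f^[j]` to
`U^[j+1] = (U^[j])^[1]`. Only the values of `f` on `U` matter. -/
def IsOfClass [TopologicalSpace K] {W : Type w} [AddCommGroup W] [Module K W]
    [TopologicalSpace W] :
    ∀ (_ : ℕ) {V : Type (max u v)} [AddCommGroup V] [Module K V] [TopologicalSpace V]
      (_ : Set V) (_ : V → W), Prop
  | 0, _, _, _, _, U, f => ContinuousOn f U
  | k + 1, V, _, _, _, U, f => ContinuousOn f U ∧
      ∃ F : V × V × K → W, IsDifferenceQuotient K U f F ∧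
        IsOfClass k (cubicDomain K U) F

end Cubic

/-! ### Simplicial differential calculus, jets and Taylor polynomials -/

section Simplicial

variable (K : Type u) [CommRing K]
variable {V : Type v} [AddCommGroup V] [Module K V]
variable {W : Type w} [AddCommGroup W] [Module K W]

/-- The scalars `(s₀, s₁, …, s_k)` with the convention `s₀ = 0`. -/
def times {K : Type u} [CommRing K] {k : ℕ} (s : Fin k → K) : Fin (k + 1) → K :=
  Fin.cons (0 : K) s

/-- The `i`-th evaluation point `v₀ + ∑_{j=1}^{i} ∏_{m=0}^{j-1} (s_i - s_m) v_j`
(the term with `j = 0` is `v₀`). -/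
def node {k : ℕ} (v : Fin (k + 1) → V) (s : Fin k → K) (i : Fin (k + 1)) : V :=
  ∑ j ∈ Finset.Iic i, (∏ m ∈ Finset.Iio j, (times s i - times s m)) • v j

/-- The extended simplicial domain `U^⟨k⟩`. -/
def simplicialDomain (U : Set V) (k : ℕ) : Set ((Fin (k + 1) → V) × (Fin k → K)) :=
  {p | ∀ i, node K p.1 p.2 i ∈ U}

/-- Nonsingular parameters: all `s_i - s_m` with `i ≠ m` are invertible. -/
def Nonsingular {k : ℕ} (s : Fin k → K) : Prop :=
  ∀ i m : Fin (k + 1), i ≠ m → IsUnit (times s i - times s m)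

/-- The generalized divided difference
`f^⟩k⟨ (v; s) = ∑_i (∏_{j ≠ i} (s_i - s_j))⁻¹ f (node i)`, used for nonsingular `s` only. -/
def dividedDifference {k : ℕ} (f : V → W) (v : Fin (k + 1) → V) (s : Fin k → K) : W :=
  ∑ i, Ring.inverse (∏ j ∈ Finset.univ.erase i, (times s i - times s j)) • f (node K v s i)

/-- `F` is continuous on `U^⟨k⟩` and extends the divided difference `f^⟩k⟨`. -/
def IsSimplicialExtension [TopologicalSpace K] [TopologicalSpace V] [TopologicalSpace W]
    (U : Set V) (f : V → W) (k : ℕ) (F : (Fin (k + 1) → V) × (Fin k → K) → W) : Prop :=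
  ContinuousOn F (simplicialDomain K U k) ∧
    ∀ v s, (v, s) ∈ simplicialDomain K U k → Nonsingular K s →
      F (v, s) = dividedDifference K f v s

open Classical in
/-- The map `f^⟨k⟩ : U^⟨k⟩ → W`, the continuous extension of `f^⟩k⟨` (and `0` if there is none).
For Hausdorff `W`, open `U`, and open dense `Kˣ`, its values on `U^⟨k⟩` are unique. -/
def simplicialExt [TopologicalSpace K] [TopologicalSpace V] [TopologicalSpace W]
    (U : Set V) (f : V → W) (k : ℕ) : (Fin (k + 1) → V) × (Fin k → K) → W :=
  if h : ∃ F, IsSimplicialExtension K U f k F then h.choose else 0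

variable [TopologicalSpace K] [TopologicalSpace V] [TopologicalSpace W]

/-- The simplicial `k`-jet `J^k f (v₀, …, v_k) = (f^⟨l⟩ (v₀, …, v_l; 0))_{l = 0, …, k}`. -/
def jet (U : Set V) (f : V → W) (k : ℕ) (v : Fin (k + 1) → V) : Fin (k + 1) → W :=
  fun l => simplicialExt K U f (l : ℕ) (fun j => v (Fin.castLE (by omega) j), 0)

/-- `J^k_x f`: the restriction of `J^k f` to the fibre `{x} × V^k` of `J^k U = U × V^k`. -/
def jetAt (U : Set V) (f : V → W) (k : ℕ) (x : V) (v : Fin k → V) : Fin (k + 1) → W :=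
  jet K U f k (Fin.cons x v)

/-- The normalized differential `D^i_h f (x) = f^⟨i⟩ (x, h, 0, …, 0; 0)`. -/
def normalizedDifferential (U : Set V) (f : V → W) (i : ℕ) (x h : V) : W :=
  simplicialExt K U f i
    (fun j : Fin (i + 1) => if (j : ℕ) = 0 then x else if (j : ℕ) = 1 then h else 0, 0)

/-- The Taylor polynomial without constant term, `Tay_x^k f (h) = ∑_{i=1}^k D^i_h f (x)`. -/
def taylor (U : Set V) (f : V → W) (k : ℕ) (x : V) : V → W :=
  fun h => ∑ i ∈ Finset.Icc 1 k, normalizedDifferential K U f i x h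

end Simplicial

/-! ### Polynomial maps and their scalar extensions -/

section Polynomial

variable (K : Type u) [CommRing K]
variable {V : Type v} [AddCommGroup V] [Module K V]
variable {W : Type w} [AddCommGroup W] [Module K W]

open Classical in
/-- `p : V → W` is homogeneous polynomial of degree `d`: for every system of generators `(e_i)`
of `V` there are coefficients `a_α ∈ W` with
`p (∑ t_i e_i) = ∑_{|α| = d} t^α a_α` for all finitely supported `t`.
(If `t^α ≠ 0` then the support of `α` lies in that of `t`, so the sum is finite.) -/
def IsHomogeneousPolynomial (d : ℕ) (p : V → W) : Prop :=
  ∀ (I : Type v) (e : I → V), Submodule.span K (Set.range e) = ⊤ →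
    ∃ a : (I →₀ ℕ) → W, ∀ t : I →₀ K,
      p (t.sum fun i r => r • e i) =
        ∑ α ∈ t.support.finsuppAntidiag d, (α.prod fun i n => t i ^ n) • a α

/-- A polynomial map: a finite sum of homogeneous polynomial maps. -/
def IsPolynomialMap (P : V → W) : Prop :=
  ∃ (N : ℕ) (p : ℕ → V → W), (∀ d, IsHomogeneousPolynomial K d (p d)) ∧
    P = ∑ d ∈ Finset.range (N + 1), p d

/-- The truncation `R = P mod (deg > k)`: the polynomial map `P` is a finite sum of homogeneous
polynomial maps `p_d` of degree `d`, and `R` is the sum of those with `d ≤ k`. -/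
def IsTruncation (k : ℕ) (P R : V → W) : Prop :=
  ∃ (N : ℕ) (p : ℕ → V → W), (∀ d, IsHomogeneousPolynomial K d (p d)) ∧
    P = ∑ d ∈ Finset.range (N + 1), p d ∧
    R = ∑ d ∈ (Finset.range (N + 1)).filter (fun d => d ≤ k), p d

/-- The monomial `c^α = ∏ c_i ^ α_i` (for `α ≠ 0`) in a commutative associative `K`-algebra `A`
which need not have a unit. The product is computed in the unitization `K ⊕ A`, where it lies
in `A` as soon as `α ≠ 0`. -/
def monomialValue (A : Type*) [NonUnitalCommRing A] [Module K A] [IsScalarTower K A A]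
    [SMulCommClass K A A] {I : Type*} (c : I →₀ A) (α : I →₀ ℕ) : A :=
  (α.prod fun i n => (Unitization.inr (c i) : Unitization K A) ^ n).snd

open Classical in
/-- `Q = P_A : V ⊗ A → W ⊗ A` is the scalar extension from `K` to the (possibly non-unital)
commutative algebra `A` of the polynomial map `P : V → W` without constant term: for all
generators `(e_i)` of `V` and every expression `P (∑ t_i e_i) = ∑_α t^α a_α` of `P`, one has
`Q (∑ e_i ⊗ c_i) = ∑_α a_α ⊗ c^α`. -/
def IsScalarExtension (A : Type*) [NonUnitalCommRing A] [Module K A] [IsScalarTower K A A]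
    [SMulCommClass K A A] (P : V → W) (Q : V ⊗[K] A → W ⊗[K] A) : Prop :=
  IsPolynomialMap K P ∧ P 0 = 0 ∧
    ∀ (I : Type v) (e : I → V), Submodule.span K (Set.range e) = ⊤ →
      ∀ (N : ℕ) (a : (I →₀ ℕ) → W),
        (∀ t : I →₀ K, P (t.sum fun i r => r • e i) =
          ∑ d ∈ Finset.Icc 1 N, ∑ α ∈ t.support.finsuppAntidiag d,
            (α.prod fun i n => t i ^ n) • a α) →
        ∀ c : I →₀ A, Q (c.sum fun i r => e i ⊗ₜ[K] r) =
          ∑ d ∈ Finset.Icc 1 N, ∑ α ∈ c.support.finsuppAntidiag d,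
            a α ⊗ₜ[K] monomialValue K A c α

end Polynomial

/-! ### The jet ring -/

section JetRing

variable (K : Type u) [CommRing K] (k : ℕ)

/-- The jet ring `J^k K = K[X] / (X^(k+1))`. -/
abbrev JetRing : Type u := K[X] ⧸ Ideal.span {(Polynomial.X : K[X]) ^ (k + 1)}

/-- The class `δ` of `X`. -/
def JetRing.delta : JetRing K k := Ideal.Quotient.mk _ Polynomial.X

/-- The canonical projection `π^k : J^k K → K`, `[P] ↦ P (0)`. -/
def JetRing.proj : JetRing K k →ₐ[K] K :=
  Ideal.Quotient.liftₐ _ (Polynomial.aeval (0 : K)) (by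
    intro a ha
    obtain ⟨b, rfl⟩ := Ideal.mem_span_singleton'.1 ha
    simp)

theorem JetRing.proj_delta : JetRing.proj K k (JetRing.delta K k) = 0 := by
  have h : JetRing.proj K k (JetRing.delta K k) = Polynomial.aeval (0 : K) Polynomial.X := rfl
  rw [h, Polynomial.aeval_X]

/-- The nilpotent part `J^k_0 K = ker π^k = δ K ⊕ … ⊕ δ^k K`, an algebra without unit. -/
def nilpotentPart : NonUnitalSubalgebra K (JetRing K k) where
  carrier := {a | JetRing.proj K k a = 0}
  add_mem' := fun {a b} ha hb => by
    simp only [Set.mem_ofPred_eq] at ha hb ⊢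
    rw [map_add, ha, hb, add_zero]
  zero_mem' := map_zero (JetRing.proj K k)
  mul_mem' := fun {a b} ha hb => by
    simp only [Set.mem_ofPred_eq] at ha hb ⊢
    rw [map_mul, ha, zero_mul]
  smul_mem' := fun r {a} ha => by
    simp only [Set.mem_ofPred_eq] at ha ⊢
    rw [map_smul, ha, smul_zero]

/-- The element `δ^(i+1)` of `J^k_0 K`. -/
def deltaPow (i : ℕ) : nilpotentPart K k :=
  ⟨JetRing.delta K k ^ (i + 1), by
    change JetRing.proj K k (JetRing.delta K k ^ (i + 1)) = 0
    rw [map_pow, JetRing.proj_delta, zero_pow (Nat.succ_ne_zero i)]⟩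

/-- The identification `V^k ≅ J^k_0 V = V ⊗ J^k_0 K`,
`(v₁, …, v_k) ↦ v₁ ⊗ δ + … + v_k ⊗ δ^k`. -/
def nilpotentVector {V : Type v} [AddCommGroup V] [Module K V] (v : Fin k → V) :
    V ⊗[K] nilpotentPart K k :=
  ∑ i : Fin k, v i ⊗ₜ[K] deltaPow K k i

end JetRing

end WeilJet

end

/-! Every assertion is a comparison of asymptotic expansions as `σ` tends to `0` through the units.
A `W`-valued polynomial in `σ` of degree at most `k` that is `o(σ^k)` has only zero coefficients,
because `0` is adherent to the units and `W` is Hausdorff (`eq_of_isFlat_sum_sub`). So two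
expansions of one curve agree coefficient by coefficient, and no derivative has to be computed.

The expansions come from Newton interpolation (`IsOfClass.newton`). For the times `0, …, 0, σ` it
says that `f (∑ σ^j v_j)` equals `∑ σ^l f^⟨l⟩(v; 0)` up to `o(σ^k)`: the jet is the list of
coefficients of `f` along a polynomial curve. The vectors `(x, h, 0, …, 0)` give the Taylor
expansion, and `h` may vary with `σ` as long as it converges. Since a curve starting at `x` is `x +
σ c(σ)`, its image under `f` is also `f x` plus the Taylor polynomial of its increment. Hence the
Taylor polynomial determines the jet, which is (i).

For (ii), iterated difference quotients show that `f` agrees with a polynomial function to order `k`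
on finite families of vectors, so normalized differentials are homogeneous polynomials. Their
coefficients are unique by Vandermonde inversion at nodes with invertible differences, which density
of the units provides. Inserting polynomial curves into the Taylor polynomial and reading
coefficients up to `σ^k` is computation in `K[X]/(X^(k+1))`, that is, scalar extension to the
nilpotent part.

For (iii), a map of class `C^[k]` with `k ≥ 1` preserves agreement of curves to order `k`
(`IsOfClass.isFlat_comp_sub`). So `g ∘ h` along `x + σ y` has the expansion of the composed Taylor
polynomials, and homogeneous parts of degree above `k` are absorbed in the remainder. -/

namespace WeilJet

open Filter Topology

/-! ### Remainders of order `o(σ^k)` and uniqueness of expansions. -/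

section Flat

variable {K : Type u} [CommRing K] [TopologicalSpace K]
variable {W : Type w} [AddCommGroup W] [Module K W] [TopologicalSpace W]

/-- `r σ = o(σ^k)` as `σ` tends to `0` through the units of `K`. -/
def IsFlat (k : ℕ) (r : K → W) : Prop :=
  Tendsto (fun σ : K => Ring.inverse σ ^ k • r σ) (𝓝[{t : K | IsUnit t}] 0) (𝓝 0)

theorem eventually_isUnit : ∀ᶠ σ : K in 𝓝[{t : K | IsUnit t}] 0, IsUnit σ :=
  eventually_mem_nhdsWithin

theorem neBot_nhdsWithin_units (hdense : Dense {t : K | IsUnit t}) :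
    (𝓝[{t : K | IsUnit t}] (0 : K)).NeBot :=
  mem_closure_iff_nhdsWithin_neBot.1 (hdense 0)

theorem IsFlat.congr' {k : ℕ} {r r' : K → W} (h : IsFlat k r)
    (hr : ∀ᶠ σ : K in 𝓝[{t : K | IsUnit t}] 0, r σ = r' σ) : IsFlat k r' :=
  Tendsto.congr' (hr.mono fun σ h => by simp only [h]) h

theorem isFlat_pow_smul {k : ℕ} {ρ : K → W}
    (h : Tendsto ρ (𝓝[{t : K | IsUnit t}] 0) (𝓝 0)) : IsFlat k fun σ => σ ^ k • ρ σ := by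
  refine Tendsto.congr' (eventually_isUnit.mono fun σ hσ => ?_) h
  dsimp only
  rw [smul_smul, ← mul_pow, Ring.inverse_mul_cancel _ hσ, one_pow, one_smul]

theorem isFlat_zero (k : ℕ) : IsFlat k fun _ : K => (0 : W) := by
  simp only [IsFlat, smul_zero]
  exact tendsto_const_nhds

theorem IsFlat.smul_succ {k : ℕ} {r : K → W} (h : IsFlat k r) :
    IsFlat (k + 1) fun σ => σ • r σ := by
  refine Tendsto.congr' (eventually_isUnit.mono fun σ hσ => ?_) h
  dsimp only
  rw [smul_smul, pow_succ, mul_assoc, Ring.inverse_mul_cancel _ hσ, mul_one]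

section

variable [ContinuousSMul K W]

theorem IsFlat.const_smul {k : ℕ} {r : K → W} (h : IsFlat k r) (c : K) :
    IsFlat k fun σ => c • r σ := by
  have := Tendsto.smul (tendsto_const_nhds (x := c)) h
  rw [smul_zero] at this
  exact this.congr fun σ => smul_comm _ _ _

theorem IsFlat.of_succ {k : ℕ} {r : K → W} (h : IsFlat (k + 1) r) : IsFlat k r := by
  have h0 : Tendsto (fun σ : K => σ) (𝓝[{t : K | IsUnit t}] 0) (𝓝 0) :=
    tendsto_id.mono_left nhdsWithin_le_nhds
  have := Tendsto.smul h0 h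
  rw [smul_zero] at this
  refine this.congr' (eventually_isUnit.mono fun σ hσ => ?_)
  rw [smul_smul, pow_succ', ← mul_assoc, Ring.mul_inverse_cancel _ hσ, one_mul]

theorem isFlat_pow_succ_smul_const (k : ℕ) (b : W) : IsFlat k fun σ : K => σ ^ (k + 1) • b := by
  have h0 : Tendsto (fun σ : K => σ • b) (𝓝[{t : K | IsUnit t}] 0) (𝓝 0) := by
    have : Continuous fun σ : K => σ • b := by fun_prop
    simpa using (this.tendsto 0).mono_left nhdsWithin_le_nhds
  simpa only [pow_succ, mul_smul] using isFlat_pow_smul (k := k) h0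

/-- Truncating `q` discards a multiple of `X^(k+1)`, and the spare factor `σ` tends to `0`. -/
theorem isFlat_eval_smul_sub [IsTopologicalRing K] (k : ℕ) (q : K[X]) (b : W) :
    IsFlat k fun σ : K => q.eval σ • b -
      ∑ l ∈ Finset.range (k + 1), σ ^ l • (q.coeff l • b) := by
  obtain ⟨r, hr⟩ : (Polynomial.X : K[X]) ^ (k + 1) ∣
      q - ∑ l ∈ Finset.range (k + 1), Polynomial.monomial l (q.coeff l) := by
    rw [Polynomial.X_pow_dvd_iff]
    intro d hd
    simp [Polynomial.finsetSum_coeff, Polynomial.coeff_monomial, hd]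
  have h0 : Tendsto (fun σ : K => (σ * r.eval σ) • b) (𝓝[{t : K | IsUnit t}] 0) (𝓝 0) := by
    have : Continuous fun σ : K => (σ * r.eval σ) • b := by fun_prop
    simpa using (this.tendsto 0).mono_left nhdsWithin_le_nhds
  refine (isFlat_pow_smul (k := k) h0).congr' (Eventually.of_forall fun σ => ?_)
  have h1 := congrArg (Polynomial.eval σ) hr
  simp only [Polynomial.eval_sub, Polynomial.eval_finsetSum, Polynomial.eval_monomial,
    Polynomial.eval_mul, Polynomial.eval_pow, Polynomial.eval_X] at h1
  simp only [smul_smul, ← Finset.sum_smul, ← sub_smul]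
  congr 1
  rw [Finset.sum_congr rfl fun l _ => mul_comm (σ ^ l) (q.coeff l), h1]
  ring

end

variable [IsTopologicalAddGroup W]

theorem IsFlat.add {k : ℕ} {r r' : K → W} (h : IsFlat k r) (h' : IsFlat k r') :
    IsFlat k fun σ => r σ + r' σ := by
  have := Tendsto.add h h'
  simpa only [IsFlat, smul_add, add_zero] using this

theorem IsFlat.sub {k : ℕ} {r r' : K → W} (h : IsFlat k r) (h' : IsFlat k r') :
    IsFlat k fun σ => r σ - r' σ := by
  have := Tendsto.sub h h'
  simpa only [IsFlat, smul_sub, sub_zero] using this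

theorem IsFlat.sum {ι : Type*} (s : Finset ι) {k : ℕ} {r : ι → K → W}
    (h : ∀ i ∈ s, IsFlat k (r i)) : IsFlat k fun σ => ∑ i ∈ s, r i σ := by
  classical
  induction s using Finset.induction_on with
  | empty => simpa using isFlat_zero k
  | insert a s ha ih =>
    simp only [Finset.sum_insert ha]
    exact (h a (Finset.mem_insert_self a s)).add
      (ih fun i hi => h i (Finset.mem_insert_of_mem hi))

variable [ContinuousSMul K W]

/-- Induction on `k`: the top term is itself of lower order, so the lower coefficients vanish first.
What remains is `σ^k • b`, and cancelling `σ^k` leaves a constant that tends to `0`. -/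
theorem eq_zero_of_isFlat_sum [T2Space W] (hdense : Dense {t : K | IsUnit t}) {k : ℕ}
    {b : ℕ → W} (h : IsFlat k fun σ : K => ∑ l ∈ Finset.range (k + 1), σ ^ l • b l) :
    ∀ l ≤ k, b l = 0 := by
  have := neBot_nhdsWithin_units hdense
  have key : ∀ (n : ℕ) (c : W), IsFlat n (fun σ : K => σ ^ n • c) → c = 0 := by
    intro n c hc
    have h1 : Tendsto (fun _ : K => c) (𝓝[{t : K | IsUnit t}] 0) (𝓝 0) := by
      refine Tendsto.congr' (eventually_isUnit.mono fun σ hσ => ?_) hc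
      rw [smul_smul, ← mul_pow, Ring.inverse_mul_cancel _ hσ, one_pow, one_smul]
    exact tendsto_nhds_unique tendsto_const_nhds h1
  induction k with
  | zero =>
    intro l hl
    obtain rfl : l = 0 := by omega
    exact key 0 _ (by simpa using h)
  | succ k ih =>
    have h2 := (h.of_succ).sub (isFlat_pow_succ_smul_const k (b (k + 1)))
    have h3 : ∀ l ≤ k, b l = 0 := by
      refine ih (h2.congr' (Eventually.of_forall fun σ => ?_))
      rw [Finset.sum_range_succ _ (k + 1), add_sub_cancel_right]
    intro l hl
    rcases Nat.lt_or_ge k l with hlt | hle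
    · obtain rfl : l = k + 1 := by omega
      refine key (k + 1) _ (h.congr' (Eventually.of_forall fun σ => ?_))
      rw [Finset.sum_range_succ, Finset.sum_eq_zero, zero_add]
      intro i hi
      rw [h3 i (by simpa [Nat.lt_succ_iff] using hi), smul_zero]
    · exact h3 l hle

theorem eq_of_isFlat_sum_sub [T2Space W] (hdense : Dense {t : K | IsUnit t}) {k : ℕ}
    {b c : ℕ → W} (h : IsFlat k fun σ : K => ∑ l ∈ Finset.range (k + 1), σ ^ l • b l -
      ∑ l ∈ Finset.range (k + 1), σ ^ l • c l) :
    ∀ l ≤ k, b l = c l := by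
  intro l hl
  refine sub_eq_zero.1 (eq_zero_of_isFlat_sum hdense (b := fun l => b l - c l)
    (h.congr' (Eventually.of_forall fun σ => ?_)) l hl)
  rw [← Finset.sum_sub_distrib]
  simp only [smul_sub]

end Flat

/-! ### Newton nodes and their difference quotients. -/

section Nodes

variable {K : Type u} [CommRing K] {V : Type v} [AddCommGroup V] [Module K V]

@[simp] theorem times_zero {k : ℕ} (s : Fin k → K) : times s 0 = 0 := rfl

@[simp] theorem times_succ {k : ℕ} (s : Fin k → K) (i : Fin k) : times s i.succ = s i := rfl

theorem sum_Iic_succ {M : Type*} [AddCommMonoid M] {k : ℕ} (g : Fin (k + 1) → M) (i : Fin k) :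
    ∑ j ∈ Finset.Iic i.succ, g j = g 0 + ∑ j ∈ Finset.Iic i, g j.succ := by
  have h1 : (Finset.Iic i.succ) = Finset.univ.filter fun j => j ≤ i.succ := by ext; simp
  have h2 : (Finset.Iic i) = Finset.univ.filter fun j => j ≤ i := by ext; simp
  rw [h1, h2, Finset.sum_filter, Finset.sum_filter, Fin.sum_univ_succ]
  simp

theorem prod_Iio_succ {M : Type*} [CommMonoid M] {k : ℕ} (g : Fin (k + 1) → M) (i : Fin k) :
    ∏ j ∈ Finset.Iio i.succ, g j = g 0 * ∏ j ∈ Finset.Iio i, g j.succ := by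
  have h1 : (Finset.Iio i.succ) = Finset.univ.filter fun j => j < i.succ := by ext; simp
  have h2 : (Finset.Iio i) = Finset.univ.filter fun j => j < i := by ext; simp
  rw [h1, h2, Finset.prod_filter, Finset.prod_filter, Fin.prod_univ_succ]
  simp

theorem Iio_zero_fin (k : ℕ) : Finset.Iio (0 : Fin (k + 1)) = ∅ := by
  ext; simp

theorem Iic_zero_fin (k : ℕ) : Finset.Iic (0 : Fin (k + 1)) = {0} := by
  ext; simp

@[simp] theorem node_zero {k : ℕ} (v : Fin (k + 1) → V) (s : Fin k → K) :
    node K v s 0 = v 0 := by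
  simp [node, Iic_zero_fin, Iio_zero_fin]

/-- The vectors in `V × V × K` whose Newton curve is the difference quotient of the
Newton curve of `v`. -/
def stepVec {k : ℕ} (v : Fin (k + 2) → V) (s : Fin (k + 1) → K) : Fin (k + 1) → V × V × K :=
  fun i => (if i = 0 then v 0 else 0, v i.succ,
    if i = 0 then s 0 else if (i : ℕ) = 1 then 1 else 0)

/-- The parameters `s₂ - s₁, …, s_{k+1} - s₁`. -/
def stepTimes {k : ℕ} (s : Fin (k + 1) → K) : Fin k → K := fun j => s j.succ - s 0

/-- The difference quotient of the Newton curve of `v` at the node of index `i + 1`. -/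
def quotNode {k : ℕ} (v : Fin (k + 2) → V) (s : Fin (k + 1) → K) (i : Fin (k + 1)) : V :=
  ∑ j ∈ Finset.Iic i, (∏ m ∈ Finset.Iio j, (s i - s m)) • v j.succ

theorem times_stepTimes {k : ℕ} (s : Fin (k + 1) → K) (i : Fin (k + 1)) :
    times (stepTimes s) i = s i - s 0 := by
  refine Fin.cases ?_ (fun j => ?_) i
  · simp
  · rw [times_succ]; rfl

/-- As `s₀ = 0`, every weight except the first contains the factor `s_i - s₀ = s_i`, which can be
pulled out. -/
theorem node_succ {k : ℕ} (v : Fin (k + 2) → V) (s : Fin (k + 1) → K) (i : Fin (k + 1)) :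
    node K v s i.succ = v 0 + s i • quotNode v s i := by
  rw [node, sum_Iic_succ, Iio_zero_fin, Finset.prod_empty, one_smul, quotNode, Finset.smul_sum]
  congr 1
  refine Finset.sum_congr rfl fun j _ => ?_
  rw [prod_Iio_succ, smul_smul]
  simp

/-- The Newton form of the identity at the first nonzero-index node: `s i = s 0 + (s i - s 0) * 1`,
with no higher terms. -/
theorem sum_stepVec_scalar {k : ℕ} (s : Fin (k + 1) → K) (i : Fin (k + 1)) :
    ∑ j ∈ Finset.Iic i, (∏ m ∈ Finset.Iio j, (s i - s m)) *
      (if j = 0 then s 0 else if (j : ℕ) = 1 then 1 else 0) = s i := by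
  refine Fin.cases ?_ (fun i => ?_) i
  · simp [Iic_zero_fin, Iio_zero_fin]
  · rw [sum_Iic_succ, Iio_zero_fin]
    obtain _ | k := k
    · exact i.elim0
    · rw [Finset.sum_eq_single 0]
      · rw [prod_Iio_succ, Iio_zero_fin, if_neg (Fin.succ_ne_zero _), if_pos (by simp)]
        simp
      · intro b _ hb
        have : (b : ℕ) ≠ 0 := fun h => hb (Fin.ext h)
        rw [if_neg (Fin.succ_ne_zero _), if_neg (by rw [Fin.val_succ]; omega), mul_zero]
      · intro h
        exact absurd (by simp) h

/-- The reason for the choice of `stepVec`: at its nodes `f^[1]` is the difference quotient of `f`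
between node `0` and node `i + 1`. Only differences of times enter, so shifting them by `s 0` is
harmless. -/
theorem node_step {k : ℕ} (v : Fin (k + 2) → V) (s : Fin (k + 1) → K) (i : Fin (k + 1)) :
    node K (stepVec v s) (stepTimes s) i = (v 0, quotNode v s i, s i) := by
  have hw : ∀ j : Fin (k + 1), ∏ m ∈ Finset.Iio j,
      (times (stepTimes s) i - times (stepTimes s) m) = ∏ m ∈ Finset.Iio j, (s i - s m) := by
    intro j
    refine Finset.prod_congr rfl fun m _ => ?_
    rw [times_stepTimes, times_stepTimes]; ring
  simp only [node, hw]
  refine Prod.ext ?_ (Prod.ext ?_ ?_)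
  · rw [Prod.fst_sum, Finset.sum_eq_single 0]
    · simp [stepVec, Iio_zero_fin]
    · intro b _ hb
      simp [stepVec, hb]
    · intro h
      exact absurd (by simp) h
  · rw [Prod.snd_sum, Prod.fst_sum]
    rfl
  · rw [Prod.snd_sum, Prod.snd_sum]
    exact sum_stepVec_scalar s i

theorem step_mem_simplicialDomain {U : Set V} {k : ℕ} {v : Fin (k + 2) → V}
    {s : Fin (k + 1) → K} (h : (v, s) ∈ simplicialDomain K U (k + 1)) :
    (stepVec v s, stepTimes s) ∈ simplicialDomain K (cubicDomain K U) k := by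
  intro i
  have h0 : node K v s 0 ∈ U := h 0
  have h1 : node K v s i.succ ∈ U := h i.succ
  change node K (stepVec v s) (stepTimes s) i ∈ _
  rw [node_step]
  rw [node_zero] at h0
  rw [node_succ] at h1
  exact ⟨h0, h1⟩

theorem Nonsingular.step {k : ℕ} {s : Fin (k + 1) → K} (h : Nonsingular K s) :
    Nonsingular K (stepTimes s) := by
  intro i m him
  have := h i.succ m.succ (by simpa using him)
  rw [times_stepTimes, times_stepTimes]
  simpa using this

end Nodes

/-! ### Lagrange weights sum to zero. -/

section Weights

variable {K : Type u} [CommRing K]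

/-- This is the recursion of divided differences for the constant `1`: writing `s a - s b = (s i - s
b) - (s i - s a)` cancels one of the two factors in the weight of each `i ∈ S`. -/
theorem sum_lagrangeWeight_insert_insert {ι : Type*} [DecidableEq ι] (s : ι → K) (S : Finset ι)
    {a b : ι} (ha : a ∉ S) (hb : b ∉ S) (hab : a ≠ b)
    (hs : ∀ i ∈ insert a (insert b S), ∀ j ∈ insert a (insert b S), i ≠ j → IsUnit (s i - s j)) :
    (s a - s b) * ∑ i ∈ insert a (insert b S),
        Ring.inverse (∏ j ∈ (insert a (insert b S)).erase i, (s i - s j)) =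
      ∑ i ∈ insert a S, Ring.inverse (∏ j ∈ (insert a S).erase i, (s i - s j)) -
      ∑ i ∈ insert b S, Ring.inverse (∏ j ∈ (insert b S).erase i, (s i - s j)) := by
  have hab' : a ∉ insert b S := by simp [hab, ha]
  have hu := hs a (by simp) b (by simp) hab
  have hu' := hs b (by simp) a (by simp) hab.symm
  rw [Finset.sum_insert hab', Finset.sum_insert hb, Finset.sum_insert ha, Finset.sum_insert hb,
    Finset.erase_insert hab', Finset.erase_insert ha, Finset.erase_insert hb,
    Finset.insert_comm a b S, Finset.erase_insert (by simp [hab.symm, hb]),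
    Finset.prod_insert hb, Finset.prod_insert ha, Ring.mul_inverse_rev, Ring.mul_inverse_rev]
  have hS : ∀ i ∈ S, (s a - s b) * Ring.inverse (∏ j ∈ (insert b (insert a S)).erase i,
      (s i - s j)) = Ring.inverse (∏ j ∈ (insert a S).erase i, (s i - s j)) -
        Ring.inverse (∏ j ∈ (insert b S).erase i, (s i - s j)) := by
    intro i hi
    have hia : a ≠ i := fun h => ha (h ▸ hi)
    have hib : b ≠ i := fun h => hb (h ▸ hi)
    have hua := hs i (by simp [hi]) a (by simp) hia.symm
    have hub := hs i (by simp [hi]) b (by simp) hib.symm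
    rw [Finset.erase_insert_of_ne hib, Finset.erase_insert_of_ne hia,
      Finset.erase_insert_of_ne hib,
      Finset.prod_insert (by simp [hab.symm, hb]), Finset.prod_insert (by simp [ha]),
      Finset.prod_insert (by simp [hb]), Ring.mul_inverse_rev, Ring.mul_inverse_rev,
      Ring.mul_inverse_rev]
    have e1 := Ring.mul_inverse_cancel _ hua
    have e2 := Ring.mul_inverse_cancel _ hub
    set A := Ring.inverse (s i - s a)
    set B := Ring.inverse (s i - s b)
    set P := Ring.inverse (∏ x ∈ S.erase i, (s i - s x))
    linear_combination P * A * e2 - P * B * e1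
  have e1 := Ring.mul_inverse_cancel _ hu
  have e2 := Ring.mul_inverse_cancel _ hu'
  rw [mul_add, mul_add, Finset.mul_sum, Finset.sum_congr rfl hS, Finset.sum_sub_distrib]
  linear_combination (Ring.inverse (∏ i ∈ S, (s a - s i))) * e1 -
    (Ring.inverse (∏ i ∈ S, (s b - s i))) * e2

/-- The divided difference of a constant vanishes as soon as there are two nodes. -/
theorem sum_lagrangeWeight_eq_zero {ι : Type*} [DecidableEq ι] (s : ι → K) (S : Finset ι)
    (hS : 2 ≤ S.card) (hs : ∀ i ∈ S, ∀ j ∈ S, i ≠ j → IsUnit (s i - s j)) :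
    ∑ i ∈ S, Ring.inverse (∏ j ∈ S.erase i, (s i - s j)) = 0 := by
  obtain ⟨n, hn⟩ := Nat.exists_eq_add_of_le hS
  induction n generalizing S with
  | zero =>
    obtain ⟨a, b, hab, rfl⟩ := Finset.card_eq_two.1 hn
    have h := sum_lagrangeWeight_insert_insert s ∅ (a := a) (b := b) (by simp) (by simp) hab
      (by simpa using hs)
    have hu := hs a (by simp) b (by simp) hab
    refine hu.mul_left_cancel ?_
    rw [mul_zero]
    simpa using h
  | succ n ih =>
    obtain ⟨a, b, ha, hb, hab⟩ := Finset.one_lt_card_iff.1 (show 1 < S.card by omega)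
    have hSe : S = insert a (insert b ((S.erase a).erase b)) := by
      rw [Finset.insert_erase (by simp [hab.symm, hb]), Finset.insert_erase ha]
    set T := (S.erase a).erase b with hT
    have haT : a ∉ T := by simp [hT]
    have hbT : b ∉ T := by simp [hT]
    have hc : T.card + 2 = S.card := by
      rw [hSe, Finset.card_insert_of_notMem (by simp [hab, haT]),
        Finset.card_insert_of_notMem hbT]
    rw [hSe] at hs ⊢
    have h := sum_lagrangeWeight_insert_insert s T haT hbT hab hs
    rw [ih (insert a T) (by rw [Finset.card_insert_of_notMem haT]; omega)
      (fun i hi j hj => hs i (by simp at hi ⊢; tauto) j (by simp at hj ⊢; tauto))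
      (by rw [Finset.card_insert_of_notMem haT]; omega),
      ih (insert b T) (by rw [Finset.card_insert_of_notMem hbT]; omega)
      (fun i hi j hj => hs i (by simp at hi ⊢; tauto) j (by simp at hj ⊢; tauto))
      (by rw [Finset.card_insert_of_notMem hbT]; omega), sub_zero] at h
    exact (hs a (by simp) b (by simp) hab).mul_left_cancel (by rw [h, mul_zero])

end Weights

/-! ### Density of nonsingular parameters. -/

section Density

variable {K : Type u} [CommRing K] [TopologicalSpace K]

theorem continuous_times {k : ℕ} (i : Fin (k + 1)) :
    Continuous fun s : Fin k → K => times s i := by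
  refine Fin.cases ?_ (fun j => ?_) i
  · exact continuous_const
  · exact continuous_apply j

variable [IsTopologicalRing K]

/-- A finite intersection of open dense sets is dense. Each single condition is dense because moving
one coordinate alone lets `s_i - s_m` run through the units. -/
theorem dense_nonsingular (hopen : IsOpen {t : K | IsUnit t}) (hdense : Dense {t : K | IsUnit t})
    (k : ℕ) : Dense {s : Fin k → K | Nonsingular K s} := by
  have hone : ∀ p : Fin (k + 1) × Fin (k + 1), p.1 ≠ p.2 →
      Dense {s : Fin k → K | IsUnit (times s p.1 - times s p.2)} := by
    have hsucc : ∀ (i : Fin k) (m : Fin (k + 1)), i.succ ≠ m →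
        Dense {s : Fin k → K | IsUnit (times s i.succ - times s m)} := by
      intro i m him s
      have hc : Continuous fun r : K => Function.update s i (r + times s m) := by fun_prop
      have h := map_mem_closure hc (hdense (s i - times s m))
        (t := {s : Fin k → K | IsUnit (times s i.succ - times s m)}) ?_
      · simpa using h
      · intro r hr
        have hm : times (Function.update s i (r + times s m)) m = times s m := by
          revert him
          refine Fin.cases (fun _ => rfl) (fun j hj => ?_) m
          rw [times_succ, times_succ, Function.update_of_ne]
          exact fun h => hj (by rw [h])
        change IsUnit (_ - _)
        rw [hm]
        simpa using hr
    rintro ⟨i, m⟩ him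
    dsimp only at him ⊢
    revert him
    refine Fin.cases (fun h0 => ?_) (fun j hj => hsucc j m hj) i
    obtain ⟨j, rfl⟩ := Fin.exists_succ_eq_of_ne_zero h0.symm
    have h1 := hsucc j 0 h0.symm
    have h2 : {s : Fin k → K | IsUnit (times s 0 - times s j.succ)} =
        {s : Fin k → K | IsUnit (times s j.succ - times s 0)} := by
      ext s
      exact ⟨fun h => by simpa using h.neg, fun h => by simpa using h.neg⟩
    rwa [h2]
  have hall : Dense (⋂₀ ((fun p : Fin (k + 1) × Fin (k + 1) =>
      {s : Fin k → K | IsUnit (times s p.1 - times s p.2)}) '' {p | p.1 ≠ p.2})) := by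
    refine (Set.toFinite _).dense_sInter ?_ ?_
    · rintro _ ⟨p, _, rfl⟩
      exact hopen.preimage ((continuous_times p.1).sub (continuous_times p.2))
    · rintro _ ⟨p, hp, rfl⟩
      exact hone p hp
  refine hall.mono fun s hs i m him => ?_
  exact hs _ ⟨(i, m), him, rfl⟩

end Density

/-! ### Continuous extensions; from cubic to simplicial difference quotients. -/

section Extension

variable {K : Type u} [CommRing K] [TopologicalSpace K] [IsTopologicalRing K]
variable {V : Type v} [AddCommGroup V] [Module K V] [TopologicalSpace V]
  [IsTopologicalAddGroup V] [ContinuousSMul K V]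
variable {W : Type w} [AddCommGroup W] [Module K W] [TopologicalSpace W]

omit [IsTopologicalRing K] in
theorem isOpen_cubicDomain {U : Set V} (hU : IsOpen U) : IsOpen (cubicDomain K U) :=
  (hU.preimage continuous_fst).inter
    (hU.preimage (f := fun p : V × V × K => p.1 + p.2.2 • p.2.1) (by fun_prop))

-- Without the inverse of `t` both sides are continuous on the open set `U^[1]`, so equality for the
-- dense set of invertible `t` passes to all `t`. Later arguments use the difference quotient in
-- this form.
omit [IsTopologicalRing K] in
theorem IsDifferenceQuotient.add_smul [IsTopologicalAddGroup W] [ContinuousSMul K W] [T2Space W]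
    (hdense : Dense {t : K | IsUnit t}) {U : Set V} (hU : IsOpen U) {f : V → W}
    (hf : ContinuousOn f U) {F : V × V × K → W} (hF : IsDifferenceQuotient K U f F)
    {x y : V} {t : K} (h : (x, y, t) ∈ cubicDomain K U) :
    f (x + t • y) = f x + t • F (x, y, t) := by
  have hd : Dense {p : V × V × K | IsUnit p.2.2} := by
    have h1 : {p : V × V × K | IsUnit p.2.2} =
        (Set.univ : Set V) ×ˢ ((Set.univ : Set V) ×ˢ {t : K | IsUnit t}) := by
      ext p; simp
    rw [h1]
    exact dense_univ.prod (dense_univ.prod hdense)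
  have key : Set.EqOn (fun p : V × V × K => f (p.1 + p.2.2 • p.2.1))
      (fun p => f p.1 + p.2.2 • F p) (cubicDomain K U) := by
    refine Set.EqOn.of_subset_closure (s := cubicDomain K U ∩ {p : V × V × K | IsUnit p.2.2})
      ?_ ?_ ?_ Set.inter_subset_left (hd.open_subset_closure_inter (isOpen_cubicDomain hU))
    · rintro ⟨x, y, t⟩ ⟨hp, ht⟩
      obtain ⟨t, rfl⟩ := ht
      dsimp only
      rw [hF.2 x y t hp, smul_smul, Units.mul_inv, one_smul, add_sub_cancel]
    · exact hf.comp (by fun_prop) fun p hp => hp.2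
    · refine (hf.comp (by fun_prop) fun p hp => hp.1).add (ContinuousOn.smul (by fun_prop) hF.1)
  exact key h

theorem continuous_node {k : ℕ} (i : Fin (k + 1)) :
    Continuous fun p : (Fin (k + 1) → V) × (Fin k → K) => node K p.1 p.2 i := by
  have := fun i => continuous_times (K := K) (k := k) i
  unfold node
  fun_prop

theorem isOpen_simplicialDomain {U : Set V} (hU : IsOpen U) (k : ℕ) :
    IsOpen (simplicialDomain K U k) := by
  have : simplicialDomain K U k = ⋂ i, {p | node K p.1 p.2 i ∈ U} := by
    ext p; simp [simplicialDomain]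
  rw [this]
  exact isOpen_iInter_of_finite fun i => hU.preimage (continuous_node i)

theorem IsSimplicialExtension.eqOn [T2Space W] (hopen : IsOpen {t : K | IsUnit t})
    (hdense : Dense {t : K | IsUnit t}) {U : Set V} (hU : IsOpen U) {f : V → W} {k : ℕ}
    {F G : (Fin (k + 1) → V) × (Fin k → K) → W} (hF : IsSimplicialExtension K U f k F)
    (hG : IsSimplicialExtension K U f k G) : Set.EqOn F G (simplicialDomain K U k) := by
  have hd : Dense {p : (Fin (k + 1) → V) × (Fin k → K) | Nonsingular K p.2} := by
    have h1 : {p : (Fin (k + 1) → V) × (Fin k → K) | Nonsingular K p.2} =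
        (Set.univ : Set (Fin (k + 1) → V)) ×ˢ {s : Fin k → K | Nonsingular K s} := by
      ext p; simp
    rw [h1]
    exact dense_univ.prod (dense_nonsingular hopen hdense k)
  refine Set.EqOn.of_subset_closure (s := simplicialDomain K U k ∩ {p | Nonsingular K p.2})
    ?_ hF.1 hG.1 Set.inter_subset_left
    (hd.open_subset_closure_inter (isOpen_simplicialDomain hU k))
  rintro ⟨v, s⟩ ⟨h1, h2⟩
  rw [hF.2 v s h1 h2, hG.2 v s h1 h2]

omit [IsTopologicalRing K] [IsTopologicalAddGroup V] [ContinuousSMul K V] in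
theorem isSimplicialExtension_simplicialExt {U : Set V} {f : V → W} {k : ℕ}
    (h : ∃ F, IsSimplicialExtension K U f k F) :
    IsSimplicialExtension K U f k (simplicialExt K U f k) := by
  rw [simplicialExt, dif_pos h]
  exact h.choose_spec

-- The factor `(s i)⁻¹` of the difference quotient is the one that the Lagrange weight of node `i +
-- 1` gains when node `0` is added. The coefficients of `f (v 0)` also match, because all weights
-- together sum to zero.
omit [IsTopologicalRing K] [IsTopologicalAddGroup V] [ContinuousSMul K V] in
theorem dividedDifference_step {U : Set V} {f : V → W} {F : V × V × K → W}
    (hF : IsDifferenceQuotient K U f F) {k : ℕ} {v : Fin (k + 2) → V}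
    {s : Fin (k + 1) → K} (h : (v, s) ∈ simplicialDomain K U (k + 1)) (hs : Nonsingular K s) :
    dividedDifference K F (stepVec v s) (stepTimes s) = dividedDifference K f v s := by
  have hF' : ∀ i : Fin (k + 1), F (node K (stepVec v s) (stepTimes s) i) =
      Ring.inverse (s i) • (f (node K v s i.succ) - f (v 0)) := by
    intro i
    have hmem := step_mem_simplicialDomain h i
    have hu : IsUnit (s i) := by simpa using hs i.succ 0 (Fin.succ_ne_zero i)
    dsimp only at hmem
    rw [node_step] at hmem ⊢
    obtain ⟨t, ht⟩ := hu
    rw [node_succ]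
    rw [← ht] at hmem ⊢
    rw [hF.2 _ _ t hmem, Ring.inverse_unit]
  have herase : ∀ i : Fin (k + 1), ∏ j ∈ Finset.univ.erase i.succ, (times s i.succ - times s j) =
      s i * ∏ j ∈ Finset.univ.erase i, (times (stepTimes s) i - times (stepTimes s) j) := by
    intro i
    have h1 : (Finset.univ : Finset (Fin (k + 2))).erase i.succ =
        insert 0 ((Finset.univ.erase i).map (Fin.succEmb (k + 1))) := by
      ext j
      refine Fin.cases ?_ (fun j => ?_) j
      · simp [(Fin.succ_ne_zero i).symm]
      · simp [Fin.succ_ne_zero]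
    rw [h1, Finset.prod_insert (by simp [Fin.succ_ne_zero]), Finset.prod_map]
    simp [times_stepTimes]
  have hsum := sum_lagrangeWeight_eq_zero (times s) Finset.univ (by simp)
    fun i _ j _ hij => hs i j hij
  rw [Fin.sum_univ_succ] at hsum
  rw [dividedDifference, dividedDifference, Fin.sum_univ_succ (n := k + 1), node_zero,
    eq_neg_of_add_eq_zero_left hsum, neg_smul, Finset.sum_smul, neg_add_eq_sub,
    ← Finset.sum_sub_distrib]
  refine Finset.sum_congr rfl fun i _ => ?_
  rw [hF', herase, Ring.mul_inverse_rev, smul_smul, smul_sub]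

omit [IsTopologicalAddGroup V] [ContinuousSMul K V] in
theorem isSimplicialExtension_step {U : Set V} {f : V → W} {F : V × V × K → W}
    (hF : IsDifferenceQuotient K U f F) {k : ℕ}
    {G : (Fin (k + 1) → V × V × K) × (Fin k → K) → W}
    (hG : IsSimplicialExtension K (cubicDomain K U) F k G) :
    IsSimplicialExtension K U f (k + 1) fun p => G (stepVec p.1 p.2, stepTimes p.2) := by
  constructor
  · refine hG.1.comp (Continuous.continuousOn ?_) fun p hp => step_mem_simplicialDomain hp
    refine Continuous.prodMk (continuous_pi fun i => ?_) (continuous_pi fun i => ?_)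
    · refine Continuous.prodMk ?_ (Continuous.prodMk (by fun_prop) ?_)
      · split_ifs <;> fun_prop
      · split_ifs <;> fun_prop
    · unfold stepTimes
      fun_prop
  · intro v s h hs
    rw [← dividedDifference_step hF h hs]
    exact hG.2 _ _ (step_mem_simplicialDomain h) hs.step

end Extension

/-! ### Existence of `f^⟨k⟩` for maps of class `C^[k]`. -/

section OfClass

theorem IsOfClass.continuousOn {K : Type u} [CommRing K] [TopologicalSpace K]
    {W : Type w} [AddCommGroup W] [Module K W] [TopologicalSpace W]
    {V : Type (max u v)} [AddCommGroup V] [Module K V] [TopologicalSpace V]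
    {k : ℕ} {U : Set V} {f : V → W}
    (hf : IsOfClass.{u, v, w} K k U f) : ContinuousOn f U := by
  cases k with
  | zero => exact hf
  | succ k => exact hf.1

theorem IsOfClass.of_succ {K : Type u} [CommRing K] [TopologicalSpace K]
    {W : Type w} [AddCommGroup W] [Module K W] [TopologicalSpace W] {k : ℕ} :
    ∀ {V : Type (max u v)} [AddCommGroup V] [Module K V] [TopologicalSpace V]
    {U : Set V} {f : V → W}, IsOfClass.{u, v, w} K (k + 1) U f →
      IsOfClass.{u, v, w} K k U f := by
  induction k with
  | zero => intro V _ _ _ U f hf; exact hf.1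
  | succ k ih =>
    intro V _ _ _ U f hf
    obtain ⟨h1, F, hF, h2⟩ := hf
    exact ⟨h1, F, hF, ih h2⟩

theorem IsOfClass.of_le {K : Type u} [CommRing K] [TopologicalSpace K]
    {W : Type w} [AddCommGroup W] [Module K W] [TopologicalSpace W]
    {V : Type (max u v)} [AddCommGroup V] [Module K V] [TopologicalSpace V]
    {k l : ℕ} (hl : l ≤ k) {U : Set V} {f : V → W}
    (hf : IsOfClass.{u, v, w} K k U f) : IsOfClass.{u, v, w} K l U f := by
  induction hl with
  | refl => exact hf
  | step _ ih => exact ih hf.of_succ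

variable {K : Type u} [CommRing K] [TopologicalSpace K] [IsTopologicalRing K]
variable {W : Type w} [AddCommGroup W] [Module K W] [TopologicalSpace W]

theorem IsOfClass.exists_isSimplicialExtension {k : ℕ} :
    ∀ {V : Type (max u v)} [AddCommGroup V] [Module K V] [TopologicalSpace V]
    [IsTopologicalAddGroup V] [ContinuousSMul K V] {U : Set V} {f : V → W},
    IsOfClass.{u, v, w} K k U f → ∃ F, IsSimplicialExtension K U f k F := by
  induction k with
  | zero =>
    intro V _ _ _ _ _ U f hf
    refine ⟨fun p => f (p.1 0), ContinuousOn.comp hf (by fun_prop) fun p hp => ?_, ?_⟩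
    · simpa using hp 0
    · intro v s _ _
      simp [dividedDifference]
  | succ k ih =>
    intro V _ _ _ _ _ U f hf
    obtain ⟨-, F, hF, h2⟩ := hf
    obtain ⟨G, hG⟩ := ih h2
    exact ⟨_, isSimplicialExtension_step hF hG⟩

end OfClass

/-! ### Nodes for infinite sequences, so that data of different lengths are compared directly. -/

section Sequences

variable {K : Type u} [CommRing K] {V : Type v} [AddCommGroup V] [Module K V]
variable {W : Type w} [AddCommGroup W] [Module K W]

/-- The `i`-th node of a sequence of vectors and a sequence of parameters. -/
def seqNode (v : ℕ → V) (s : ℕ → K) (i : ℕ) : V :=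
  ∑ j ∈ Finset.range (i + 1), (∏ m ∈ Finset.range j, (s i - s m)) • v j

/-- `stepVec` for sequences. -/
def stepSeqVec (v : ℕ → V) (s : ℕ → K) : ℕ → V × V × K :=
  fun i => (if i = 0 then v 0 else 0, v (i + 1), if i = 0 then s 1 else if i = 1 then 1 else 0)

/-- `stepTimes` for sequences. -/
def stepSeqTimes (s : ℕ → K) : ℕ → K := fun i => s (i + 1) - s 1

theorem prod_Iio_fin {M : Type*} [CommMonoid M] {n : ℕ} (g : ℕ → M) (i : Fin n) :
    ∏ j ∈ Finset.Iio i, g j = ∏ j ∈ Finset.range i, g j := by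
  have : Finset.range i = (Finset.Iio i).map Fin.valEmbedding := by
    rw [Fin.map_valEmbedding_Iio, Nat.Iio_eq_range]
  rw [this, Finset.prod_map]
  rfl

theorem sum_Iic_fin {M : Type*} [AddCommMonoid M] {n : ℕ} (g : ℕ → M) (i : Fin n) :
    ∑ j ∈ Finset.Iic i, g j = ∑ j ∈ Finset.range (i + 1), g j := by
  have : Finset.range (i + 1) = (Finset.Iic i).map Fin.valEmbedding := by
    rw [Fin.map_valEmbedding_Iic]
    ext j
    simp
  rw [this, Finset.sum_map]
  rfl

theorem times_seq {k : ℕ} {s : ℕ → K} (hs : s 0 = 0) (i : Fin (k + 1)) :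
    times (fun j : Fin k => s (j + 1)) i = s i := by
  refine Fin.cases ?_ (fun j => ?_) i
  · simp [hs]
  · simp

theorem node_seq {k : ℕ} (v : ℕ → V) {s : ℕ → K} (hs : s 0 = 0) (i : Fin (k + 1)) :
    node K (fun j : Fin (k + 1) => v j) (fun j : Fin k => s (j + 1)) i = seqNode v s i := by
  rw [node, seqNode, ← sum_Iic_fin]
  refine Finset.sum_congr rfl fun j _ => ?_
  simp only [times_seq hs]
  rw [prod_Iio_fin (fun m => s i - s m)]

omit [Module K V] in
theorem stepVec_seq {k : ℕ} (v : ℕ → V) (s : ℕ → K) :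
    stepVec (fun j : Fin (k + 2) => v j) (fun j : Fin (k + 1) => s (j + 1)) =
      fun j : Fin (k + 1) => stepSeqVec v s j := by
  funext i
  simp only [stepVec, stepSeqVec, ← Fin.val_eq_zero_iff]
  rfl

theorem stepTimes_seq {k : ℕ} (s : ℕ → K) :
    stepTimes (fun j : Fin (k + 1) => s (j + 1)) =
      fun j : Fin k => stepSeqTimes s (j + 1) := by
  funext i
  simp [stepTimes, stepSeqTimes]

theorem mem_simplicialDomain_seq {U : Set V} {k : ℕ} {v : ℕ → V} {s : ℕ → K} (hs : s 0 = 0)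
    (h : ∀ i ≤ k, seqNode v s i ∈ U) :
    ((fun j : Fin (k + 1) => v j), fun j : Fin k => s (j + 1)) ∈ simplicialDomain K U k := by
  intro i
  rw [node_seq v hs]
  exact h i (Nat.lt_succ_iff.1 i.2)

/-- When only the last time is nonzero, the Newton weights become powers of `σ` and the node runs on
a polynomial curve. -/
theorem seqNode_of_prefix_eq_zero (v : ℕ → V) {s : ℕ → K} {i : ℕ} {σ : K} (hi : s i = σ)
    (h : ∀ m < i, s m = 0) : seqNode v s i = ∑ j ∈ Finset.range (i + 1), σ ^ j • v j := by
  refine Finset.sum_congr rfl fun j hj => ?_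
  rw [Finset.prod_congr rfl (g := fun _ => σ), Finset.prod_const, Finset.card_range]
  intro m hm
  have : m < i := by
    simp only [Finset.mem_range] at hj hm
    omega
  rw [hi, h m this, sub_zero]

/-- The value of `f^⟨l⟩` at the first terms of a sequence of vectors and of a sequence of
parameters. -/
noncomputable def extSeq [TopologicalSpace K] [TopologicalSpace V] [TopologicalSpace W]
    (U : Set V) (f : V → W) (l : ℕ) (v : ℕ → V) (s : ℕ → K) : W :=
  simplicialExt K U f l (fun j : Fin (l + 1) => v j, fun j : Fin l => s (j + 1))

end Sequences

/-! ### Newton interpolation and expansion along curves. -/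

section Newton

variable {K : Type u} [CommRing K] [TopologicalSpace K] [IsTopologicalRing K]
variable {W : Type w} [AddCommGroup W] [Module K W] [TopologicalSpace W] [T2Space W]

omit [T2Space W] in
theorem extSeq_zero
    {V : Type (max u v)} [AddCommGroup V] [Module K V] [TopologicalSpace V]
    [IsTopologicalAddGroup V] [ContinuousSMul K V] {k : ℕ} {U : Set V} {f : V → W}
    (hf : IsOfClass.{u, v, w} K k U f) {v : ℕ → V} (hv : v 0 ∈ U) (s : ℕ → K) :
    extSeq U f 0 v s = f (v 0) := by
  have h := isSimplicialExtension_simplicialExt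
    (hf.of_le (Nat.zero_le k)).exists_isSimplicialExtension
  rw [extSeq, h.2]
  · simp [dividedDifference]
  · intro i
    obtain rfl : i = 0 := Fin.ext (by omega)
    simpa using hv
  · intro i m him
    exact absurd (Fin.ext (by omega)) him

theorem extSeq_step (hopen : IsOpen {t : K | IsUnit t}) (hdense : Dense {t : K | IsUnit t})
    {V : Type (max u v)} [AddCommGroup V] [Module K V] [TopologicalSpace V]
    [IsTopologicalAddGroup V] [ContinuousSMul K V] {l : ℕ} {U : Set V} (hU : IsOpen U) {f : V → W}
    (hf : IsOfClass.{u, v, w} K (l + 1) U f) {F : V × V × K → W}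
    (hF : IsDifferenceQuotient K U f F) (hF' : IsOfClass.{u, v, w} K l (cubicDomain K U) F)
    {v : ℕ → V} {s : ℕ → K} (hs : s 0 = 0) (h : ∀ i ≤ l + 1, seqNode v s i ∈ U) :
    extSeq (cubicDomain K U) F l (stepSeqVec v s) (stepSeqTimes s) = extSeq U f (l + 1) v s := by
  have h1 := isSimplicialExtension_simplicialExt hf.exists_isSimplicialExtension
  have h2 := isSimplicialExtension_step hF
    (isSimplicialExtension_simplicialExt hF'.exists_isSimplicialExtension)
  have h3 := h2.eqOn hopen hdense hU h1 (mem_simplicialDomain_seq hs h)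
  dsimp only at h3
  rwa [stepVec_seq, stepTimes_seq] at h3

variable [IsTopologicalAddGroup W] [ContinuousSMul K W]

/-- Newton's interpolation formula. -/
theorem IsOfClass.newton (hopen : IsOpen {t : K | IsUnit t}) (hdense : Dense {t : K | IsUnit t})
    {k : ℕ} : ∀ {V : Type (max u v)} [AddCommGroup V] [Module K V] [TopologicalSpace V]
    [IsTopologicalAddGroup V] [ContinuousSMul K V] {U : Set V} (_ : IsOpen U) {f : V → W}
    (_ : IsOfClass.{u, v, w} K k U f) {v : ℕ → V} {s : ℕ → K} (_ : s 0 = 0)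
    (_ : ∀ i ≤ k, seqNode v s i ∈ U),
    f (seqNode v s k) = ∑ l ∈ Finset.range (k + 1),
      (∏ m ∈ Finset.range l, (s k - s m)) • extSeq U f l v s := by
  induction k with
  | zero =>
    intro V _ _ _ _ _ U hU f hf v s hs h
    have h0 : v 0 ∈ U := by simpa [seqNode] using h 0 le_rfl
    simp [extSeq_zero hf h0, seqNode]
  | succ k ih =>
    intro V _ _ _ _ _ U hU f hf v s hs h
    obtain ⟨hc, F, hF, hF'⟩ := id hf
    have h0 : v 0 ∈ U := by simpa [seqNode] using h 0 (Nat.zero_le _)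
    have hs' : stepSeqTimes s 0 = 0 := by simp [stepSeqTimes]
    have hmem := mem_simplicialDomain_seq hs h
    have hstep : ∀ i ≤ k, seqNode (stepSeqVec v s) (stepSeqTimes s) i ∈ cubicDomain K U := by
      intro i hi
      have := step_mem_simplicialDomain hmem ⟨i, by omega⟩
      rw [stepVec_seq, stepTimes_seq] at this
      rwa [← node_seq (k := k) _ hs' ⟨i, by omega⟩]
    have hn := node_step (fun j : Fin (k + 2) => v j) (fun j : Fin (k + 1) => s (j + 1))
      (Fin.last k)
    rw [stepVec_seq, stepTimes_seq, node_seq _ hs', Fin.val_last] at hn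
    have hlast := hstep k le_rfl
    rw [hn] at hlast
    have hsucc : seqNode v s (k + 1) = _ + _ :=
      (node_seq v hs (Fin.last k).succ).symm.trans (node_succ _ _ _)
    rw [Fin.val_last] at hsucc
    -- The last node is `v₀ + s_{k+1} q`, so `f` there is `f v₀ + s_{k+1} F(v₀, q, s_{k+1})`. The
    -- induction hypothesis expands `F`, and `s_{k+1} = s_{k+1} - s₀` is the missing factor of each
    -- Newton weight.
    rw [hsucc, hF.add_smul hdense hU hc hlast, ← hn, ih (isOpen_cubicDomain hU) hF' hs' hstep,
      Finset.sum_range_succ' _ (k + 1), Finset.smul_sum, add_comm]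
    congr 1
    · refine Finset.sum_congr rfl fun l hl => ?_
      rw [Finset.mem_range] at hl
      rw [extSeq_step hopen hdense hU (hf.of_le (by omega)) hF (hF'.of_le (by omega)) hs
        fun i hi => h i (by omega), smul_smul, Finset.prod_range_succ', hs, mul_comm]
      simp [stepSeqTimes]
    · simp [extSeq_zero hf h0]

/-- Apply Newton's formula with times `0, …, 0, σ`. Only the term of top index sees the last time,
and there the error is `σ^k` times a difference of values of the continuous `f^⟨k⟩`, which tends to
`0`. -/
theorem IsOfClass.isFlat_sub_extSeq (hopen : IsOpen {t : K | IsUnit t})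
    (hdense : Dense {t : K | IsUnit t})
    {V : Type (max u v)} [AddCommGroup V] [Module K V] [TopologicalSpace V]
    [IsTopologicalAddGroup V] [ContinuousSMul K V] {k : ℕ} {U : Set V} (hU : IsOpen U) {f : V → W}
    (hf : IsOfClass.{u, v, w} K k U f) {v : K → ℕ → V} {v₀ : ℕ → V}
    (hv : ∀ j, Tendsto (fun σ => v σ j) (𝓝[{t : K | IsUnit t}] 0) (𝓝 (v₀ j))) (h0 : v₀ 0 ∈ U) :
    IsFlat k fun σ : K => f (∑ j ∈ Finset.range (k + 1), σ ^ j • v σ j) -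
      ∑ l ∈ Finset.range (k + 1), σ ^ l • extSeq U f l (v σ) (0 : ℕ → K) := by
  have hσ : Tendsto (fun σ : K => σ) (𝓝[{t : K | IsUnit t}] 0) (𝓝 0) :=
    tendsto_id.mono_left nhdsWithin_le_nhds
  have hev0 : ∀ᶠ σ in 𝓝[{t : K | IsUnit t}] 0, v σ 0 ∈ U := hv 0 (hU.mem_nhds h0)
  -- For order `0` the last time would be `s₀`, which has to stay `0`; there the remainder vanishes
  -- near `0`.
  obtain _ | k := k
  · refine (isFlat_zero 0).congr' (hev0.mono fun σ h => ?_)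
    simp [extSeq_zero hf h]
  set s : K → ℕ → K := fun σ i => if i = k + 1 then σ else 0 with hs
  have hcurve : Tendsto (fun σ => ∑ j ∈ Finset.range (k + 1 + 1), σ ^ j • v σ j)
      (𝓝[{t : K | IsUnit t}] 0) (𝓝 (v₀ 0)) := by
    have h1 := tendsto_finsetSum (Finset.range (k + 1 + 1)) fun j _ => (hσ.pow j).smul (hv j)
    have h2 : ∑ j ∈ Finset.range (k + 1 + 1), (0 : K) ^ j • v₀ j = v₀ 0 := by
      rw [Finset.sum_eq_single 0] <;> simp +contextual
    rwa [h2] at h1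
  have hρ : Tendsto (fun σ => extSeq U f (k + 1) (v σ) (s σ) - extSeq U f (k + 1) (v σ) (0 : ℕ → K))
      (𝓝[{t : K | IsUnit t}] 0) (𝓝 0) := by
    have hc := (isSimplicialExtension_simplicialExt hf.exists_isSimplicialExtension).1
    have hmem : ((fun j : Fin (k + 1 + 1) => v₀ j), fun j : Fin (k + 1) => (0 : ℕ → K) (j + 1)) ∈
        simplicialDomain K U (k + 1) := by
      refine mem_simplicialDomain_seq rfl fun i _ => ?_
      rw [seqNode_of_prefix_eq_zero v₀ (s := 0) (σ := 0) rfl fun _ _ => rfl, Finset.sum_eq_single 0]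
        <;> simp +contextual [h0]
    have hca := hc.continuousAt ((isOpen_simplicialDomain hU (k + 1)).mem_nhds hmem)
    have hsv : Tendsto (fun σ => fun j : Fin (k + 1 + 1) => v σ j) (𝓝[{t : K | IsUnit t}] 0)
      (𝓝 fun j : Fin (k + 1 + 1) => v₀ j) := tendsto_pi_nhds.2 fun j => hv j
    have hs1 : Tendsto (fun σ => fun j : Fin (k + 1) => s σ (j + 1)) (𝓝[{t : K | IsUnit t}] 0)
        (𝓝 fun j : Fin (k + 1) => (0 : ℕ → K) (j + 1)) := by
      refine tendsto_pi_nhds.2 fun j => ?_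
      by_cases hj : (j : ℕ) + 1 = k + 1
      · simpa [hs, hj] using hσ
      · simp only [hs, hj, if_false]
        exact tendsto_const_nhds
    have e1 := hca.tendsto.comp (hsv.prodMk_nhds hs1)
    have e2 := hca.tendsto.comp (hsv.prodMk_nhds tendsto_const_nhds)
    have e3 := e1.sub e2
    rw [sub_self] at e3
    exact e3
  refine (isFlat_pow_smul (k := k + 1) hρ).congr' ?_
  filter_upwards [hev0, hcurve (hU.mem_nhds h0)] with σ h1 h2
  have hlast : seqNode (v σ) (s σ) (k + 1) = ∑ j ∈ Finset.range (k + 1 + 1), σ ^ j • v σ j :=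
    seqNode_of_prefix_eq_zero _ (by simp [hs]) fun m hm => by simp [hs, hm.ne]
  have hN := hf.newton hopen hdense hU (v := v σ) (s := s σ) (by simp [hs]) (by
    intro i hi
    rcases hi.lt_or_eq with hlt | rfl
    · rw [seqNode_of_prefix_eq_zero (v σ) (σ := 0) (by simp [hs, hlt.ne])
        fun m hm => by simp [hs, (hm.trans hlt).ne], Finset.sum_eq_single 0]
        <;> simp +contextual [h1]
    · rw [hlast]
      exact h2)
  rw [hlast] at hN
  rw [hN, Finset.sum_range_succ, Finset.sum_range_succ (fun l => σ ^ l • extSeq U f l (v σ) (0 : ℕ → K))]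
  have hw : ∀ l ≤ k + 1, ∏ m ∈ Finset.range l, (s σ (k + 1) - s σ m) = σ ^ l := by
    intro l hl
    rw [Finset.prod_congr rfl (g := fun _ => σ), Finset.prod_const, Finset.card_range]
    intro m hm
    have : m ≠ k + 1 := by
      rw [Finset.mem_range] at hm
      omega
    simp [hs, this]
  have hl : ∀ l ∈ Finset.range (k + 1), (∏ m ∈ Finset.range l, (s σ (k + 1) - s σ m)) •
      extSeq U f l (v σ) (s σ) = σ ^ l • extSeq U f l (v σ) (0 : ℕ → K) := by
    intro l hl
    rw [Finset.mem_range] at hl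
    rw [hw l (by omega)]
    congr 1
    unfold extSeq
    congr 2
    funext j
    have : (j : ℕ) + 1 ≠ k + 1 := by omega
    simp only [hs, this, if_false]
    rfl
  rw [Finset.sum_congr rfl hl, hw _ le_rfl, smul_sub]
  abel

end Newton

/-! ### Monomials and polynomial functions of finitely many variables. -/

section Monomials

variable {K : Type u} [CommRing K] {W : Type w} [AddCommGroup W] [Module K W]

/-- The monomial function `t ↦ t^α`. -/
def mon {R : Type*} [CommMonoid R] {I : Type*} (t : I → R) (α : I →₀ ℕ) : R :=
  α.prod fun i n => t i ^ n

theorem mon_zero {R : Type*} [CommMonoid R] {I : Type*} (t : I → R) : mon t 0 = 1 :=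
  Finsupp.prod_zero_index

theorem mon_add {R : Type*} [CommMonoid R] {I : Type*} (t : I → R) (α β : I →₀ ℕ) :
    mon t (α + β) = mon t α * mon t β := by
  classical
  exact Finsupp.prod_add_index' (fun _ => pow_zero _) fun _ _ _ => pow_add _ _ _

theorem mon_single {R : Type*} [CommMonoid R] {I : Type*} (t : I → R) (i : I) (n : ℕ) :
    mon t (Finsupp.single i n) = t i ^ n :=
  Finsupp.prod_single_index (pow_zero _)

theorem mon_smul {I : Type*} (σ : K) (t : I → K) (α : I →₀ ℕ) :
    mon (σ • t) α = σ ^ α.degree * mon t α := by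
  simp only [mon, Finsupp.prod, Pi.smul_apply, smul_eq_mul, mul_pow, Finset.prod_mul_distrib,
    Finset.prod_pow_eq_pow_sum, Finsupp.degree_apply]

theorem mon_eq_prod {R : Type*} [CommMonoid R] {I : Type*} (t : I → R) {α : I →₀ ℕ} {S : Finset I}
    (h : α.support ⊆ S) : mon t α = ∏ i ∈ S, t i ^ α i :=
  Finsupp.prod_of_support_subset _ h _ fun _ _ => pow_zero _

theorem mon_eq_zero {I : Type*} (t : I → K) {α : I →₀ ℕ} {i : I} (hi : i ∈ α.support)
    (ht : t i = 0) : mon t α = 0 :=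
  Finset.prod_eq_zero hi (by dsimp only; rw [ht, zero_pow (Finsupp.mem_support_iff.1 hi)])

theorem mon_comp_mon {R : Type*} [CommMonoid R] {I J : Type*} (t : I → R) (b : J → I →₀ ℕ)
    (γ : J →₀ ℕ) : mon (fun j => mon t (b j)) γ = mon t (γ.sum fun j n => n • b j) := by
  classical
  induction γ using Finsupp.induction_linear with
  | zero => simp [mon_zero]
  | add γ γ' h h' =>
    rw [mon_add, h, h', ← mon_add, Finsupp.sum_add_index' (by simp) (by simp [add_smul])]
  | single j n =>
    rw [mon_single, Finsupp.sum_single_index (by simp)]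
    induction n with
    | zero => simp [mon_zero]
    | succ n ih => rw [pow_succ, ih, add_smul, one_smul, mon_add]

open Classical in
theorem mem_finsuppAntidiag_iff_degree {I : Type*} {S : Finset I} {d : ℕ} {α : I →₀ ℕ} :
    α ∈ S.finsuppAntidiag d ↔ α.degree = d ∧ α.support ⊆ S :=
  Finset.mem_finsuppAntidiag'

open Classical in
theorem sum_finsuppAntidiag_eq_of_subset {I : Type*} {S T : Finset I} (hST : S ⊆ T) (d : ℕ)
    (t : I → K) (ht : ∀ i ∈ T, i ∉ S → t i = 0) (a : (I →₀ ℕ) → W) :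
    ∑ α ∈ S.finsuppAntidiag d, mon t α • a α = ∑ α ∈ T.finsuppAntidiag d, mon t α • a α := by
  refine Finset.sum_subset (Finset.finsuppAntidiag_mono hST d) fun α hα hα' => ?_
  rw [mem_finsuppAntidiag_iff_degree] at hα hα'
  have : ¬ α.support ⊆ S := fun h => hα' ⟨hα.1, h⟩
  obtain ⟨i, hi, hiS⟩ := Finset.not_subset.1 this
  rw [mon_eq_zero t hi (ht i (hα.2 hi) hiS), zero_smul]

/-- The `W`-valued polynomial functions of degree at most `N` in the variables indexed by `S`. -/
def polyFun (K : Type u) [CommRing K] (W : Type w) [AddCommGroup W] [Module K W]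
    {I : Type*} (S : Finset I) (N : ℕ) : Submodule K ((I → K) → W) :=
  Submodule.span K {p | ∃ (α : I →₀ ℕ) (b : W), α.support ⊆ S ∧ α.degree ≤ N ∧
    p = fun t => mon t α • b}

theorem mon_smul_mem_polyFun {I : Type*} {S : Finset I} {N : ℕ} {α : I →₀ ℕ} (hS : α.support ⊆ S)
    (hN : α.degree ≤ N) (b : W) : (fun t : I → K => mon t α • b) ∈ polyFun K W S N :=
  Submodule.subset_span ⟨α, b, hS, hN, rfl⟩

theorem const_mem_polyFun {I : Type*} (S : Finset I) (N : ℕ) (b : W) :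
    (fun _ : I → K => b) ∈ polyFun K W S N := by
  simpa [mon_zero] using mon_smul_mem_polyFun (K := K) (S := S) (N := N) (α := 0) (by simp)
    (by simp) b

theorem polyFun_mono {I : Type*} {S T : Finset I} (hST : S ⊆ T) {N M : ℕ} (hNM : N ≤ M) :
    polyFun K W S N ≤ polyFun K W T M := by
  refine Submodule.span_mono ?_
  rintro _ ⟨α, b, h1, h2, rfl⟩
  exact ⟨α, b, h1.trans hST, h2.trans hNM, rfl⟩

theorem coord_smul_mem_polyFun {I : Type*} {S : Finset I} {N : ℕ} {i : I} (hi : i ∈ S)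
    {p : (I → K) → W} (hp : p ∈ polyFun K W S N) :
    (fun t : I → K => t i • p t) ∈ polyFun K W S (N + 1) := by
  classical
  induction hp using Submodule.span_induction with
  | mem p hp =>
    obtain ⟨α, b, h1, h2, rfl⟩ := hp
    have := mon_smul_mem_polyFun (K := K) (S := S) (N := N + 1) (α := Finsupp.single i 1 + α)
      (Finsupp.support_add.trans (Finset.union_subset
        (Finsupp.support_single_subset.trans (by simpa using hi)) h1))
      (by rw [map_add, Finsupp.degree_single]; omega) b
    simpa only [mon_add, mon_single, pow_one, mul_smul] using this
  | zero =>
    simp only [Pi.zero_apply, smul_zero]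
    exact (polyFun K W S (N + 1)).zero_mem
  | add p q _ _ h1 h2 =>
    simp only [Pi.add_apply, smul_add]
    exact Submodule.add_mem _ h1 h2
  | smul c p _ h =>
    have := Submodule.smul_mem _ c h
    refine (congrArg (· ∈ polyFun K W S (N + 1)) ?_).mp this
    funext t
    simp only [Pi.smul_apply]
    exact smul_comm _ _ _

/-- Meant for composing Taylor polynomials: the inner one is a combination of fixed vectors with
monomial coefficients, so the outer one is evaluated at monomials. -/
theorem comp_mon_mem_polyFun {I J : Type*} {S : Finset I} {T : Finset J} {N M : ℕ}
    (b : J → I →₀ ℕ) (hS : ∀ j ∈ T, (b j).support ⊆ S) (hN : ∀ j ∈ T, (b j).degree ≤ N)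
    {p : (J → K) → W} (hp : p ∈ polyFun K W T M) :
    (fun t : I → K => p fun j => mon t (b j)) ∈ polyFun K W S (N * M) := by
  classical
  induction hp using Submodule.span_induction with
  | mem p hp =>
    obtain ⟨γ, c, h1, h2, rfl⟩ := hp
    simp only [mon_comp_mon]
    refine mon_smul_mem_polyFun ?_ ?_ c
    · refine Finsupp.support_sum.trans (Finset.biUnion_subset.2 fun j hj => ?_)
      exact Finsupp.support_smul.trans (hS j (h1 hj))
    · rw [Finsupp.sum, map_sum]
      calc ∑ j ∈ γ.support, (γ j • b j).degree ≤ ∑ j ∈ γ.support, γ j * N := by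
            refine Finset.sum_le_sum fun j hj => ?_
            rw [map_nsmul, smul_eq_mul]
            exact Nat.mul_le_mul_left _ (hN j (h1 hj))
        _ = N * γ.degree := by rw [← Finset.sum_mul, Finsupp.degree_apply, mul_comm]
        _ ≤ N * M := Nat.mul_le_mul_left _ h2
  | zero => exact (polyFun K W S (N * M)).zero_mem
  | add p q _ _ h1 h2 => exact Submodule.add_mem _ h1 h2
  | smul c p _ h => exact Submodule.smul_mem _ c h

open Classical in
theorem exists_coeff_of_mem_polyFun {I : Type*} {S : Finset I} {N : ℕ} {p : (I → K) → W}
    (hp : p ∈ polyFun K W S N) : ∃ a : (I →₀ ℕ) → W, ∀ t, p t =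
      ∑ d ∈ Finset.range (N + 1), ∑ α ∈ S.finsuppAntidiag d, mon t α • a α := by
  induction hp using Submodule.span_induction with
  | mem p hp =>
    obtain ⟨α, b, h1, h2, rfl⟩ := hp
    refine ⟨Pi.single α b, fun t => ?_⟩
    rw [Finset.sum_eq_single α.degree]
    · rw [Finset.sum_eq_single α]
      · simp
      · intro β _ hβ
        rw [Pi.single_eq_of_ne hβ, smul_zero]
      · intro h
        exact absurd (mem_finsuppAntidiag_iff_degree.2 ⟨rfl, h1⟩) h
    · intro d _ hd
      refine Finset.sum_eq_zero fun β hβ => ?_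
      rw [mem_finsuppAntidiag_iff_degree] at hβ
      rw [Pi.single_eq_of_ne, smul_zero]
      rintro rfl
      exact hd hβ.1.symm
    · intro h
      exact absurd (Finset.mem_range.2 (Nat.lt_succ_of_le h2)) h
  | zero => exact ⟨0, fun t => by simp⟩
  | add p q _ _ h1 h2 =>
    obtain ⟨a, ha⟩ := h1
    obtain ⟨b, hb⟩ := h2
    refine ⟨a + b, fun t => ?_⟩
    simp only [Pi.add_apply, ha, hb, smul_add, Finset.sum_add_distrib]
  | smul c p _ h =>
    obtain ⟨a, ha⟩ := h
    refine ⟨c • a, fun t => ?_⟩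
    simp only [Pi.smul_apply, ha, Finset.smul_sum]
    refine Finset.sum_congr rfl fun d _ => Finset.sum_congr rfl fun α _ => smul_comm _ _ _

open Classical in
theorem sum_finsuppAntidiag_smul {I : Type*} (S : Finset I) (d : ℕ) (σ : K) (t : I → K)
    (a : (I →₀ ℕ) → W) : ∑ α ∈ S.finsuppAntidiag d, mon (σ • t) α • a α =
      σ ^ d • ∑ α ∈ S.finsuppAntidiag d, mon t α • a α := by
  rw [Finset.smul_sum]
  refine Finset.sum_congr rfl fun α hα => ?_
  rw [mon_smul, (mem_finsuppAntidiag_iff_degree.1 hα).1, mul_smul]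

end Monomials

/-! ### Uniqueness of coefficients by interpolation. -/

section Coefficients

variable {K : Type u} [CommRing K]

/-- If `K` has enough nodes then the coefficients of a polynomial function of degree at most `N`
are linear combinations of its values at these nodes. -/
theorem exists_coeff_functional {N : ℕ} {r : Fin N → K} (hr : Nonsingular K r) :
    ∃ c : ℕ → Fin (N + 1) → K, ∀ l m, m ≤ N →
      ∑ i, c l i * times r i ^ m = if l = m then 1 else 0 := by
  have hdet : IsUnit (Matrix.vandermonde (times r)).det := by
    rw [Matrix.det_vandermonde, IsUnit.prod_univ_iff]
    intro i
    rw [IsUnit.prod_iff]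
    intro j hj
    exact hr j i (Finset.mem_Ioi.1 hj).ne'
  have hinv := Matrix.nonsing_inv_mul _ hdet
  -- The rows of the inverse Vandermonde matrix are the coefficient functionals. For `l > N` the
  -- value `0` is correct, since `m ≤ N` excludes `l = m`.
  refine ⟨fun l i => if h : l < N + 1 then (Matrix.vandermonde (times r))⁻¹ ⟨l, h⟩ i else 0,
    fun l m hm => ?_⟩
  by_cases h : l < N + 1
  · have := congrFun (congrFun hinv ⟨l, h⟩) ⟨m, by omega⟩
    rw [Matrix.mul_apply, Matrix.one_apply] at this
    simpa [h, Matrix.vandermonde_apply] using this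
  · have hlm : l ≠ m := by omega
    simp [h, hlm]

variable {W : Type w} [AddCommGroup W] [Module K W]

-- The product over `i ∈ S` of the one-variable functionals for `β i`, summed over the grid of
-- nodes, sends `t^α` to `1` if `α = β` and to `0` otherwise. It therefore isolates `a β`.
open Classical in
theorem eq_zero_of_sum_finsuppAntidiag_eq_zero {d : ℕ} (hK : ∃ r : Fin d → K, Nonsingular K r)
    {I : Type*} {S : Finset I} {a : (I →₀ ℕ) → W}
    (h : ∀ t : I → K, ∑ α ∈ S.finsuppAntidiag d, mon t α • a α = 0) :
    ∀ α ∈ S.finsuppAntidiag d, a α = 0 := by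
  intro β hβ
  obtain ⟨r, hr⟩ := hK
  obtain ⟨c, hc⟩ := exists_coeff_functional hr
  have hsum : ∀ α ∈ S.finsuppAntidiag d,
      ∑ x : S → Fin (d + 1), (∏ i : S, c (β i) (x i)) *
        mon (fun i => if h : i ∈ S then times r (x ⟨i, h⟩) else 0) α =
      if β = α then 1 else 0 := by
    intro α hα
    have hαd : ∀ i : S, α i ≤ d := fun i =>
      (Finsupp.le_degree (i : I) α).trans (mem_finsuppAntidiag_iff_degree.1 hα).1.le
    have h1 : ∀ x : S → Fin (d + 1), (∏ i : S, c (β i) (x i)) *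
        mon (fun i => if h : i ∈ S then times r (x ⟨i, h⟩) else 0) α =
        ∏ i : S, (c (β i) (x i) * times r (x i) ^ α i) := by
      intro x
      have h2 : mon (fun i => if h : i ∈ S then times r (x ⟨i, h⟩) else 0) α =
          ∏ i : S, times r (x i) ^ α i := by
        rw [mon_eq_prod _ (mem_finsuppAntidiag_iff_degree.1 hα).2,
          ← Finset.prod_coe_sort S fun i =>
            (if h : i ∈ S then times r (x ⟨i, h⟩) else 0) ^ α i]
        exact Finset.prod_congr rfl fun i _ => by rw [dif_pos i.2]
      rw [h2, Finset.prod_mul_distrib]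
    simp only [h1]
    have h3 := Finset.prod_univ_sum (fun _ : S => (Finset.univ : Finset (Fin (d + 1))))
      fun i j => c (β i) j * times r j ^ α i
    rw [Fintype.piFinset_univ] at h3
    have h4 : ∀ i : S, ∑ j, c (β i) j * times r j ^ α i = if β i = α i then 1 else 0 :=
      fun i => hc _ _ (hαd i)
    rw [← h3]
    simp only [h4]
    split_ifs with hβα
    · subst hβα
      simp
    · have : ∃ i : S, β i ≠ α i := by
        by_contra! hall
        refine hβα (Finsupp.ext fun i => ?_)
        by_cases hi : i ∈ S
        · exact hall ⟨i, hi⟩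
        · rw [Finsupp.notMem_support_iff.1
            fun h => hi ((mem_finsuppAntidiag_iff_degree.1 hβ).2 h),
            Finsupp.notMem_support_iff.1
            fun h => hi ((mem_finsuppAntidiag_iff_degree.1 hα).2 h)]
      obtain ⟨i, hi⟩ := this
      exact Finset.prod_eq_zero (Finset.mem_univ i) (if_neg hi)
  have h2 : ∑ x : S → Fin (d + 1), (∏ i : S, c (β i) (x i)) • ∑ α ∈ S.finsuppAntidiag d,
      mon (fun i => if h : i ∈ S then times r (x ⟨i, h⟩) else 0) α • a α = 0 :=
    Finset.sum_eq_zero fun x _ => by rw [h, smul_zero]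
  simp only [Finset.smul_sum, smul_smul] at h2
  rw [Finset.sum_comm] at h2
  simp only [← Finset.sum_smul] at h2
  rw [Finset.sum_congr rfl fun α hα => by rw [hsum α hα]] at h2
  simpa [hβ] using h2

end Coefficients

/-! ### Homogeneous polynomial maps from their restrictions to finite families. -/

section Homogeneous

variable {K : Type u} [CommRing K]
variable {V : Type v} [AddCommGroup V] [Module K V]
variable {W : Type w} [AddCommGroup W] [Module K W]

-- Coefficients found separately on finite subfamilies are compatible by uniqueness, as is seen by
-- setting the variables outside the smaller family to zero. So `a_α` can be taken from the support
-- of `α`.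
open Classical in
theorem isHomogeneousPolynomial_of_finite {d : ℕ} (hK : ∃ r : Fin d → K, Nonsingular K r)
    {p : V → W} (h : ∀ (I : Type v) (e : I → V) (S : Finset I), ∃ a : (I →₀ ℕ) → W,
      ∀ t : I → K, p (∑ i ∈ S, t i • e i) = ∑ α ∈ S.finsuppAntidiag d, mon t α • a α) :
    IsHomogeneousPolynomial K d p := by
  intro I e _
  choose a ha using h I e
  have key : ∀ S T : Finset I, S ⊆ T → ∀ α ∈ S.finsuppAntidiag d, a S α = a T α := by
    intro S T hST α hα
    refine sub_eq_zero.1 (eq_zero_of_sum_finsuppAntidiag_eq_zero hK (S := S)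
      (a := fun α => a S α - a T α) (fun t => ?_) α hα)
    simp only [smul_sub, Finset.sum_sub_distrib]
    set t' : I → K := fun i => if i ∈ S then t i else 0
    have h1 : ∀ b : (I →₀ ℕ) → W, ∑ α ∈ S.finsuppAntidiag d, mon t α • b α =
        ∑ α ∈ S.finsuppAntidiag d, mon t' α • b α := by
      intro b
      refine Finset.sum_congr rfl fun α hα => ?_
      have hs := (mem_finsuppAntidiag_iff_degree.1 hα).2
      rw [mon_eq_prod _ hs, mon_eq_prod _ hs]
      congr 1
      refine Finset.prod_congr rfl fun i hi => ?_
      simp [t', hi]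
    rw [h1, h1, sum_finsuppAntidiag_eq_of_subset hST d t' (fun i _ hi => if_neg hi) (a T),
      ← ha, ← ha, sub_eq_zero]
    congr 1
    refine Finset.sum_subset hST fun i _ hi => ?_
    rw [show t' i = 0 from if_neg hi, zero_smul]
  refine ⟨fun α => a α.support α, fun t => ?_⟩
  refine (ha t.support t).trans (Finset.sum_congr rfl fun α hα => ?_)
  have hα' := mem_finsuppAntidiag_iff_degree.1 hα
  dsimp only
  rw [key α.support t.support hα'.2 α (mem_finsuppAntidiag_iff_degree.2 ⟨hα'.1, subset_rfl⟩)]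
  rfl

open Classical in
/-- A map that is polynomial of bounded degree on finite families decomposes into homogeneous
polynomial maps. -/
theorem exists_homogeneous_components (hK : ∀ n, ∃ r : Fin n → K, Nonsingular K r) {N : ℕ}
    {C : V → W} (hC : ∀ (I : Type v) (e : I → V) (S : Finset I),
      (fun t : I → K => C (∑ i ∈ S, t i • e i)) ∈ polyFun K W S N) :
    ∃ p : ℕ → V → W, (∀ d, IsHomogeneousPolynomial K d (p d)) ∧
      C = ∑ d ∈ Finset.range (N + 1), p d ∧ ∀ d (σ : K) y, p d (σ • y) = σ ^ d • p d y := by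
  obtain ⟨r, hr⟩ := hK N
  obtain ⟨c, hc⟩ := exists_coeff_functional hr
  have key : ∀ (I : Type v) (e : I → V) (S : Finset I), ∃ a : (I →₀ ℕ) → W,
      (∀ t : I → K, C (∑ i ∈ S, t i • e i) =
        ∑ d ∈ Finset.range (N + 1), ∑ α ∈ S.finsuppAntidiag d, mon t α • a α) ∧
      ∀ (d : ℕ) (t : I → K), ∑ j, c d j • C (times r j • ∑ i ∈ S, t i • e i) =
        if d ≤ N then ∑ α ∈ S.finsuppAntidiag d, mon t α • a α else 0 := by
    intro I e S
    obtain ⟨a, ha⟩ := exists_coeff_of_mem_polyFun (hC I e S)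
    refine ⟨a, ha, fun d t => ?_⟩
    have h1 : ∀ j, C (times r j • ∑ i ∈ S, t i • e i) = ∑ m ∈ Finset.range (N + 1),
        times r j ^ m • ∑ α ∈ S.finsuppAntidiag m, mon t α • a α := by
      intro j
      have := ha (times r j • t)
      simp only [sum_finsuppAntidiag_smul] at this
      rw [← this, Finset.smul_sum]
      simp only [Pi.smul_apply, smul_eq_mul, mul_smul]
    simp only [h1, Finset.smul_sum (s := Finset.range (N + 1)), smul_smul]
    rw [Finset.sum_comm]
    simp only [← Finset.sum_smul]
    rw [Finset.sum_congr rfl fun m hm => by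
      rw [hc d m (Nat.lt_succ_iff.1 (Finset.mem_range.1 hm))]]
    simp
  -- The part of degree `d` is the coefficient of `σ^d` in `C (σ • y)`, extracted by interpolation.
  -- It is thus defined from `C` alone, with no choice of generators, and is `0` for `d > N`.
  refine ⟨fun d y => ∑ j, c d j • C (times r j • y), fun d => ?_, ?_, ?_⟩
  · refine isHomogeneousPolynomial_of_finite (hK d) fun I e S => ?_
    obtain ⟨a, -, ha⟩ := key I e S
    by_cases hd : d ≤ N
    · exact ⟨a, fun t => (ha d t).trans (if_pos hd)⟩
    · exact ⟨0, fun t => ((ha d t).trans (if_neg hd)).trans (by simp)⟩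
  · funext y
    obtain ⟨a, ha, ha'⟩ := key PUnit (fun _ => y) Finset.univ
    have h1 := ha fun _ => 1
    have h2 := fun d => ha' d fun _ => 1
    simp only [one_smul, Finset.univ_unique, Finset.sum_singleton] at h1 h2
    rw [Finset.sum_apply, h1]
    refine Finset.sum_congr rfl fun d hd => ?_
    rw [h2, if_pos (Nat.lt_succ_iff.1 (Finset.mem_range.1 hd))]
  · intro d σ y
    obtain ⟨a, -, ha⟩ := key PUnit (fun _ => y) Finset.univ
    have h1 := ha d (σ • fun _ => 1)
    have h2 := ha d fun _ => 1
    rw [sum_finsuppAntidiag_smul] at h1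
    simp only [one_smul, Finset.univ_unique, Finset.sum_singleton, Pi.smul_apply, smul_eq_mul,
      mul_one] at h1 h2
    dsimp only
    rw [h1, h2]
    split_ifs
    · rfl
    · rw [smul_zero]

end Homogeneous

/-! ### Stability of the class `C^[k]`; the chain rule. -/

section ChainRule

variable {K : Type u} [CommRing K] [TopologicalSpace K]

theorem IsOfClass.mono_set {W : Type w} [AddCommGroup W] [Module K W] [TopologicalSpace W] {k : ℕ} :
    ∀ {V : Type (max u v)} [AddCommGroup V] [Module K V] [TopologicalSpace V] {U U' : Set V}
    (_ : U' ⊆ U) {f : V → W}, IsOfClass.{u, v, w} K k U f → IsOfClass.{u, v, w} K k U' f := by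
  induction k with
  | zero => intro V _ _ _ U U' h f hf; exact ContinuousOn.mono hf h
  | succ k ih =>
    intro V _ _ _ U U' h f hf
    obtain ⟨h1, F, hF, h2⟩ := hf
    have hsub : cubicDomain K U' ⊆ cubicDomain K U := fun p hp => ⟨h hp.1, h hp.2⟩
    exact ⟨h1.mono h, F, ⟨hF.1.mono hsub, fun x y t ht => hF.2 x y t (hsub ht)⟩, ih hsub h2⟩

theorem IsOfClass.comp_continuousLinearMap {W : Type w} [AddCommGroup W] [Module K W]
    [TopologicalSpace W] {k : ℕ} :
    ∀ {V V₂ : Type (max u v)} [AddCommGroup V] [Module K V] [TopologicalSpace V]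
    [AddCommGroup V₂] [Module K V₂] [TopologicalSpace V₂] (L : V →L[K] V₂) {U : Set V₂}
    {f : V₂ → W}, IsOfClass.{u, v, w} K k U f →
      IsOfClass.{u, v, w} K k (L ⁻¹' U) (fun x => f (L x)) := by
  induction k with
  | zero =>
    intro V V₂ _ _ _ _ _ _ L U f hf
    exact ContinuousOn.comp hf L.continuous.continuousOn fun x hx => hx
  | succ k ih =>
    intro V V₂ _ _ _ _ _ _ L U f hf
    obtain ⟨h1, F, hF, h2⟩ := hf
    have h3 := ih (L.prodMap (L.prodMap (ContinuousLinearMap.id K K))) h2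
    have hpre : (L.prodMap (L.prodMap (ContinuousLinearMap.id K K))) ⁻¹' cubicDomain K U =
        cubicDomain K (L ⁻¹' U) := by
      ext ⟨x, y, t⟩
      simp [cubicDomain]
    rw [hpre] at h3
    refine ⟨h1.comp L.continuous.continuousOn fun x hx => hx, _, ⟨h3.continuousOn, ?_⟩, h3⟩
    intro x y t h
    have := hF.2 (L x) (L y) t (by simpa [cubicDomain] using h)
    simpa using this

theorem isOfClass_continuousLinearMap {W : Type w} [AddCommGroup W] [Module K W]
    [TopologicalSpace W] {k : ℕ} :
    ∀ {V : Type (max u v)} [AddCommGroup V] [Module K V] [TopologicalSpace V] (U : Set V)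
    (L : V →L[K] W), IsOfClass.{u, v, w} K k U L := by
  induction k with
  | zero => intro V _ _ _ U L; exact L.continuous.continuousOn
  | succ k ih =>
    intro V _ _ _ U L
    have h := ih (cubicDomain K U)
      (L.comp ((ContinuousLinearMap.fst K V K).comp (ContinuousLinearMap.snd K V (V × K))))
    refine ⟨L.continuous.continuousOn, _, ⟨h.continuousOn, fun x y t _ => ?_⟩, h⟩
    simp [smul_smul]

theorem IsOfClass.prodMk {W : Type w} [AddCommGroup W] [Module K W] [TopologicalSpace W]
    {W₂ : Type v'} [AddCommGroup W₂] [Module K W₂] [TopologicalSpace W₂] {k : ℕ} :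
    ∀ {V : Type (max u v)} [AddCommGroup V] [Module K V] [TopologicalSpace V] {U : Set V}
    {f : V → W} {g : V → W₂}, IsOfClass.{u, v, w} K k U f → IsOfClass.{u, v, v'} K k U g →
      IsOfClass.{u, v, max w v'} K k U (fun x => (f x, g x)) := by
  induction k with
  | zero => intro V _ _ _ U f g hf hg; exact ContinuousOn.prodMk hf hg
  | succ k ih =>
    intro V _ _ _ U f g hf hg
    obtain ⟨h1, F, hF, h2⟩ := hf
    obtain ⟨h1', G, hG, h2'⟩ := hg
    refine ⟨h1.prodMk h1', _, ⟨hF.1.prodMk hG.1, fun x y t h => ?_⟩, ih h2 h2'⟩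
    dsimp only
    rw [hF.2 x y t h, hG.2 x y t h]
    rfl

/-- Induction rests on `(g ∘ h)^[1] (x, v, t) = g^[1] (h x, h^[1] (x, v, t), t)`, which is again a
composite of maps of one class less. -/
theorem IsOfClass.comp {W : Type w} [AddCommGroup W] [Module K W] [TopologicalSpace W]
    [IsTopologicalRing K] (hdense : Dense {t : K | IsUnit t}) [T2Space K] {k : ℕ} :
    ∀ {V : Type (max u v)} [AddCommGroup V] [Module K V] [TopologicalSpace V]
    [IsTopologicalAddGroup V] [ContinuousSMul K V] [T2Space V]
    {V' : Type (max u v')} [AddCommGroup V'] [Module K V'] [TopologicalSpace V']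
    [IsTopologicalAddGroup V'] [ContinuousSMul K V'] {U : Set V} {U' : Set V'} (_ : IsOpen U')
    {g : V → W} {h : V' → V}, IsOfClass.{u, v, w} K k U g →
      IsOfClass.{u, v', max u v} K k U' h → Set.MapsTo h U' U →
      IsOfClass.{u, v', w} K k U' (g ∘ h) := by
  induction k with
  | zero => intro V _ _ _ _ _ _ V' _ _ _ _ _ U U' _ g h hg hh hm; exact ContinuousOn.comp hg hh hm
  | succ k ih =>
    intro V _ _ _ _ _ _ V' _ _ _ _ _ U U' hU' g h hg hh hm
    obtain ⟨hgc, G, hG, hG'⟩ := id hg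
    obtain ⟨hhc, H, hH, hH'⟩ := id hh
    have hfst : IsOfClass.{u, v', max u v} K k (cubicDomain K U') fun p => h p.1 :=
      (hh.of_succ.comp_continuousLinearMap (ContinuousLinearMap.fst K V' (V' × K))).mono_set
        fun p hp => hp.1
    have hscal : IsOfClass.{u, v', u} K k (cubicDomain K U') fun p => p.2.2 :=
      isOfClass_continuousLinearMap _
        ((ContinuousLinearMap.snd K V' K).comp (ContinuousLinearMap.snd K V' (V' × K)))
    have hinner : IsOfClass.{u, v', max u v} K k (cubicDomain K U')
        fun p => (h p.1, H p, p.2.2) := hfst.prodMk (hH'.prodMk hscal)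
    have hmaps : Set.MapsTo (fun p : V' × V' × K => (h p.1, H p, p.2.2)) (cubicDomain K U')
        (cubicDomain K U) := by
      rintro ⟨x, y, t⟩ hp
      refine ⟨hm hp.1, ?_⟩
      dsimp only
      rw [← hH.add_smul hdense hU' hhc hp]
      exact hm hp.2
    have hcomp := ih (isOpen_cubicDomain hU') hG' hinner hmaps
    refine ⟨hgc.comp hhc hm, _, ⟨hcomp.continuousOn, fun x y t hp => ?_⟩, hcomp⟩
    have h1 := hmaps hp
    dsimp only [Function.comp_apply] at h1 ⊢
    rw [hG.2 _ _ t h1, hH.add_smul hdense hU' hhc hp]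

end ChainRule

/-! ### Taylor expansion and polynomiality of the normalized differentials. -/

section Expansion

variable {K : Type u} [CommRing K] [TopologicalSpace K]

theorem tendsto_id_units : Tendsto (fun σ : K => σ) (𝓝[{t : K | IsUnit t}] 0) (𝓝 0) :=
  tendsto_id.mono_left nhdsWithin_le_nhds

theorem tendsto_add_smul {V : Type*} [AddCommGroup V] [Module K V] [TopologicalSpace V]
    [IsTopologicalAddGroup V] [ContinuousSMul K V] (x : V) {c : K → V} {c₀ : V}
    (hc : Tendsto c (𝓝[{t : K | IsUnit t}] 0) (𝓝 c₀)) :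
    Tendsto (fun σ : K => x + σ • c σ) (𝓝[{t : K | IsUnit t}] 0) (𝓝 x) := by
  have h := (tendsto_const_nhds (x := x)).add (tendsto_id_units.smul hc)
  rwa [zero_smul, add_zero] at h

variable [IsTopologicalRing K]
variable {W : Type w} [AddCommGroup W] [Module K W] [TopologicalSpace W]
  [IsTopologicalAddGroup W] [ContinuousSMul K W] [T2Space W]

/-- On finite-dimensional slices a map of class `C^[k]` is a polynomial function of degree at most
`k`, up to a remainder of order `k`. -/
theorem IsOfClass.exists_polyFun (hdense : Dense {t : K | IsUnit t}) {k : ℕ} {I : Type*} :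
    ∀ {V : Type (max u v)} [AddCommGroup V] [Module K V] [TopologicalSpace V]
    [IsTopologicalAddGroup V] [ContinuousSMul K V] {U : Set V} (_ : IsOpen U) {f : V → W}
    (_ : IsOfClass.{u, v, w} K k U f) {x : V} (_ : x ∈ U) (e : I → V) (S : Finset I),
    ∃ p ∈ polyFun K W S k, ∀ t : I → K,
      IsFlat k fun σ : K => f (x + σ • ∑ i ∈ S, t i • e i) - p (σ • t) := by
  classical
  induction k with
  | zero =>
    intro V _ _ _ _ _ U hU f hf x hx e S
    refine ⟨fun _ => f x, const_mem_polyFun S 0 _, fun t => ?_⟩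
    have h1 : Tendsto (fun σ : K => x + σ • ∑ i ∈ S, t i • e i) (𝓝[{t : K | IsUnit t}] 0)
        (𝓝 x) := tendsto_add_smul x tendsto_const_nhds
    have h2 := (ContinuousOn.continuousAt hf (hU.mem_nhds hx)).tendsto.comp h1
    simpa [IsFlat] using h2.sub_const (f x)
  | succ k ih =>
    intro V _ _ _ _ _ U hU f hf x hx e S
    obtain ⟨hc, F, hF, hF'⟩ := hf
    induction S using Finset.induction_on with
    | empty => exact ⟨fun _ => f x, const_mem_polyFun ∅ _ _, fun t => by
        simpa using isFlat_zero (k + 1)⟩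
    | insert a S ha ihS =>
      obtain ⟨p, hp, hpf⟩ := ihS
      have hxa : (x, e a, (0 : K)) ∈ cubicDomain K U := by simpa [cubicDomain] using hx
      -- The new variable contributes `σ t_a F(x + σ ∑_S t_i e_i, e_a, σ t_a)`. The chosen family in
      -- `V × V × K` makes this argument a straight line through `(x, e_a, 0)`, so `F` is expanded
      -- to order `k` and the factor `σ t_a` restores the lost order.
      obtain ⟨q, hq, hqf⟩ := ih (isOpen_cubicDomain hU) hF' hxa
        (fun i => if i = a then (0, 0, 1) else (e i, 0, 0)) (insert a S)
      refine ⟨p + fun t => t a • q t, Submodule.add_mem _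
        (polyFun_mono (Finset.subset_insert a S) le_rfl hp)
        (coord_smul_mem_polyFun (Finset.mem_insert_self a S) hq), fun t => ?_⟩
      have hsum : ∑ i ∈ insert a S, t i • (if i = a then (0, 0, 1) else (e i, 0, 0) : V × V × K) =
          (∑ i ∈ S, t i • e i, 0, t a) := by
        have h1 : ∀ i ∈ S, t i • (if i = a then (0, 0, 1) else (e i, 0, 0) : V × V × K) =
            (t i • e i, 0, 0) := by
          intro i hi
          rw [if_neg fun h : i = a => ha (h ▸ hi)]
          simp
        rw [Finset.sum_insert ha, Finset.sum_congr rfl h1, if_pos rfl]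
        refine Prod.ext ?_ (Prod.ext ?_ ?_) <;> simp [Prod.fst_sum, Prod.snd_sum]
      have h1 := ((hqf t).const_smul (t a)).smul_succ
      refine ((hpf t).add h1).congr' ?_
      have hcurve : Tendsto (fun σ : K => (x + σ • ∑ i ∈ S, t i • e i, e a, σ * t a))
          (𝓝[{t : K | IsUnit t}] 0) (𝓝 (x, e a, 0)) := by
        refine Tendsto.prodMk_nhds ?_ (tendsto_const_nhds.prodMk_nhds ?_)
        · exact tendsto_add_smul x tendsto_const_nhds
        · simpa using tendsto_id_units.mul_const (t a)
      filter_upwards [hcurve ((isOpen_cubicDomain hU).mem_nhds hxa)] with σ hmem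
      have h2 := hF.add_smul hdense hU hc hmem
      have h3 : x + σ • ∑ i ∈ insert a S, t i • e i =
          x + σ • ∑ i ∈ S, t i • e i + (σ * t a) • e a := by
        rw [Finset.sum_insert ha, smul_add, smul_smul]
        abel
      have h4 : (x, e a, (0 : K)) + σ • (∑ i ∈ S, t i • e i, (0 : V), t a) =
          (x + σ • ∑ i ∈ S, t i • e i, e a, σ * t a) := by
        simp
      rw [hsum, h4, h3, h2]
      simp only [Pi.add_apply, Pi.smul_apply, smul_eq_mul, smul_sub, smul_smul]
      abel

variable {V : Type (max u v)} [AddCommGroup V] [Module K V] [TopologicalSpace V]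
  [IsTopologicalAddGroup V] [ContinuousSMul K V]

theorem sum_range_eq_add_sum_Icc {M : Type*} [AddCommMonoid M] (g : ℕ → M) (k : ℕ) :
    ∑ l ∈ Finset.range (k + 1), g l = g 0 + ∑ l ∈ Finset.Icc 1 k, g l := by
  rw [Finset.range_eq_Ico, Finset.sum_eq_sum_Ico_succ_bot (Nat.succ_pos k)]
  rfl

omit [IsTopologicalAddGroup W] [ContinuousSMul K W] [T2Space W] in
theorem normalizedDifferential_zero {k : ℕ} {U : Set V} {f : V → W}
    (hf : IsOfClass.{u, v, w} K k U f) {x : V} (hx : x ∈ U) (y : V) :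
    normalizedDifferential K U f 0 x y = f x :=
  extSeq_zero hf (v := fun j => if j = 0 then x else if j = 1 then y else 0) (by simpa using hx) 0

theorem IsOfClass.isFlat_sub_normalizedDifferential (hopen : IsOpen {t : K | IsUnit t})
    (hdense : Dense {t : K | IsUnit t}) {k : ℕ} {U : Set V} (hU : IsOpen U) {f : V → W}
    (hf : IsOfClass.{u, v, w} K k U f) {x : V} (hx : x ∈ U) {c : K → V} {c₀ : V}
    (hc : Tendsto c (𝓝[{t : K | IsUnit t}] 0) (𝓝 c₀)) :
    IsFlat k fun σ : K => f (x + σ • c σ) -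
      ∑ l ∈ Finset.range (k + 1), σ ^ l • normalizedDifferential K U f l x (c σ) := by
  -- For `k = 0` the curve of the general expansion is the constant `x`, so continuity of `f` at `x`
  -- is used instead.
  obtain _ | k := k
  · have h1 := tendsto_add_smul x hc
    have h2 := (ContinuousOn.continuousAt hf (hU.mem_nhds hx)).tendsto.comp h1
    simpa [IsFlat, normalizedDifferential_zero hf hx] using h2.sub_const (f x)
  · have h := hf.isFlat_sub_extSeq hopen hdense hU
      (v := fun σ j => if j = 0 then x else if j = 1 then c σ else 0)
      (v₀ := fun j => if j = 0 then x else if j = 1 then c₀ else 0) (fun j => by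
        split_ifs
        · exact tendsto_const_nhds
        · exact hc
        · exact tendsto_const_nhds) (by simpa using hx)
    refine h.congr' (Eventually.of_forall fun σ => ?_)
    rw [Finset.sum_range_succ', Finset.sum_range_succ', Finset.sum_eq_zero fun j _ => by simp]
    simp only [zero_add, pow_one, one_ne_zero, if_false, if_true, pow_zero, one_smul]
    rw [add_comm x]
    rfl

-- Along `x + σ ∑ t_i e_i` there are two expansions, one by normalized differentials and one by the
-- approximating polynomial function. Equal powers of `σ` have equal coefficients.
open Classical in
theorem IsOfClass.exists_coeff_normalizedDifferential (hopen : IsOpen {t : K | IsUnit t})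
    (hdense : Dense {t : K | IsUnit t}) {k : ℕ} {U : Set V} (hU : IsOpen U) {f : V → W}
    (hf : IsOfClass.{u, v, w} K k U f) {x : V} (hx : x ∈ U) {I : Type*} (e : I → V)
    (S : Finset I) : ∃ a : (I →₀ ℕ) → W, ∀ (t : I → K), ∀ l ≤ k,
      normalizedDifferential K U f l x (∑ i ∈ S, t i • e i) =
        ∑ α ∈ S.finsuppAntidiag l, mon t α • a α := by
  obtain ⟨p, hp, hpf⟩ := hf.exists_polyFun hdense hU hx e S
  obtain ⟨a, ha⟩ := exists_coeff_of_mem_polyFun hp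
  refine ⟨a, fun t => eq_of_isFlat_sum_sub hdense ?_⟩
  have h1 := hf.isFlat_sub_normalizedDifferential hopen hdense hU hx
    (tendsto_const_nhds (x := ∑ i ∈ S, t i • e i))
  refine ((hpf t).sub h1).congr' (Eventually.of_forall fun σ => ?_)
  rw [ha]
  simp only [sum_finsuppAntidiag_smul]
  abel

theorem IsOfClass.normalizedDifferential_smul (hopen : IsOpen {t : K | IsUnit t})
    (hdense : Dense {t : K | IsUnit t}) {k : ℕ} {U : Set V} (hU : IsOpen U) {f : V → W}
    (hf : IsOfClass.{u, v, w} K k U f) {x : V} (hx : x ∈ U) {l : ℕ} (hl : l ≤ k) (σ : K) (y : V) :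
    normalizedDifferential K U f l x (σ • y) = σ ^ l • normalizedDifferential K U f l x y := by
  classical
  obtain ⟨a, ha⟩ := hf.exists_coeff_normalizedDifferential hopen hdense hU hx
    (fun _ : Unit => y) Finset.univ
  have h1 := ha (σ • fun _ => 1) l hl
  have h2 := ha (fun _ => 1) l hl
  rw [sum_finsuppAntidiag_smul] at h1
  simp only [one_smul, Finset.univ_unique, Finset.sum_singleton, Pi.smul_apply, smul_eq_mul,
    mul_one] at h1 h2
  rw [h1, h2]

theorem IsOfClass.isHomogeneousPolynomial_normalizedDifferential
    (hopen : IsOpen {t : K | IsUnit t}) (hdense : Dense {t : K | IsUnit t}) {k : ℕ} {U : Set V}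
    (hU : IsOpen U) {f : V → W} (hf : IsOfClass.{u, v, w} K k U f) {x : V} (hx : x ∈ U) {l : ℕ}
    (hl : l ≤ k) : IsHomogeneousPolynomial K l (normalizedDifferential K U f l x) := by
  refine isHomogeneousPolynomial_of_finite (dense_nonsingular hopen hdense l).nonempty
    fun I e S => ?_
  obtain ⟨a, ha⟩ := hf.exists_coeff_normalizedDifferential hopen hdense hU hx e S
  exact ⟨a, fun t => ha t l hl⟩

theorem IsOfClass.taylor_smul (hopen : IsOpen {t : K | IsUnit t})
    (hdense : Dense {t : K | IsUnit t}) {k : ℕ} {U : Set V} (hU : IsOpen U) {f : V → W}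
    (hf : IsOfClass.{u, v, w} K k U f) {x : V} (hx : x ∈ U) (σ : K) (y : V) :
    taylor K U f k x (σ • y) =
      ∑ l ∈ Finset.Icc 1 k, σ ^ l • normalizedDifferential K U f l x y :=
  Finset.sum_congr rfl fun _ hl =>
    hf.normalizedDifferential_smul hopen hdense hU hx (Finset.mem_Icc.1 hl).2 σ y

theorem IsOfClass.isFlat_sub_taylor (hopen : IsOpen {t : K | IsUnit t})
    (hdense : Dense {t : K | IsUnit t}) {k : ℕ} {U : Set V} (hU : IsOpen U) {f : V → W}
    (hf : IsOfClass.{u, v, w} K k U f) {x : V} (hx : x ∈ U) {c : K → V} {c₀ : V}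
    (hc : Tendsto c (𝓝[{t : K | IsUnit t}] 0) (𝓝 c₀)) :
    IsFlat k fun σ : K => f (x + σ • c σ) - (f x + taylor K U f k x (σ • c σ)) := by
  refine (hf.isFlat_sub_normalizedDifferential hopen hdense hU hx hc).congr'
    (Eventually.of_forall fun σ => ?_)
  rw [hf.taylor_smul hopen hdense hU hx, sum_range_eq_add_sum_Icc,
    normalizedDifferential_zero hf hx, pow_zero, one_smul]

/-- The Taylor polynomial along a polynomial curve determines the simplicial jet. -/
theorem IsOfClass.isFlat_extSeq_sub_taylor (hopen : IsOpen {t : K | IsUnit t})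
    (hdense : Dense {t : K | IsUnit t}) {k : ℕ} {U : Set V} (hU : IsOpen U) {f : V → W}
    (hf : IsOfClass.{u, v, w} K k U f) {y : ℕ → V} (hy : y 0 ∈ U) :
    IsFlat k fun σ : K => ∑ l ∈ Finset.range (k + 1), σ ^ l • extSeq U f l y (0 : ℕ → K) -
      (f (y 0) + taylor K U f k (y 0) (∑ j ∈ Finset.range k, σ ^ (j + 1) • y (j + 1))) := by
  have hc : Continuous fun σ : K => ∑ j ∈ Finset.range k, σ ^ j • y (j + 1) := by fun_prop
  have h1 := hf.isFlat_sub_taylor hopen hdense hU hy ((hc.tendsto 0).mono_left nhdsWithin_le_nhds)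
  have h2 := hf.isFlat_sub_extSeq hopen hdense hU (v := fun _ => y) (v₀ := y)
    (fun _ => tendsto_const_nhds) hy
  -- Both expansions concern one curve, read as `x + σ c(σ)` in `h1` and as `∑ σ^j y_j` in `h2`; the
  -- values of `f` cancel.
  refine (h1.sub h2).congr' (Eventually.of_forall fun σ => ?_)
  have h3 : σ • ∑ j ∈ Finset.range k, σ ^ j • y (j + 1) =
      ∑ j ∈ Finset.range k, σ ^ (j + 1) • y (j + 1) := by
    rw [Finset.smul_sum]
    exact Finset.sum_congr rfl fun j _ => by rw [smul_smul, pow_succ']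
  rw [h3, Finset.sum_range_succ' (fun j => σ ^ j • y j), pow_zero, one_smul, add_comm (y 0)]
  abel

-- All degrees share one index set, so that the value is a combination of one finite family of
-- vectors, to which a second Taylor polynomial can be applied.
open Classical in
theorem IsOfClass.exists_coeff_taylor (hopen : IsOpen {t : K | IsUnit t})
    (hdense : Dense {t : K | IsUnit t}) {k : ℕ} {U : Set V} (hU : IsOpen U) {f : V → W}
    (hf : IsOfClass.{u, v, w} K k U f) {x : V} (hx : x ∈ U) {I : Type*} (e : I → V)
    (S : Finset I) : ∃ a : (I →₀ ℕ) → W, ∀ t : I → K, taylor K U f k x (∑ i ∈ S, t i • e i) =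
      ∑ α ∈ (Finset.Icc 1 k).biUnion S.finsuppAntidiag, mon t α • a α := by
  obtain ⟨a, ha⟩ := hf.exists_coeff_normalizedDifferential hopen hdense hU hx e S
  refine ⟨a, fun t => ?_⟩
  rw [Finset.sum_biUnion]
  · exact Finset.sum_congr rfl fun l hl => ha t l (Finset.mem_Icc.1 hl).2
  · intro d _ d' _ hdd'
    refine Finset.disjoint_left.2 fun α hα hα' => hdd' ?_
    exact (mem_finsuppAntidiag_iff_degree.1 hα).1.symm.trans
      (mem_finsuppAntidiag_iff_degree.1 hα').1

theorem IsOfClass.taylor_mem_polyFun (hopen : IsOpen {t : K | IsUnit t})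
    (hdense : Dense {t : K | IsUnit t}) {k : ℕ} {U : Set V} (hU : IsOpen U) {f : V → W}
    (hf : IsOfClass.{u, v, w} K k U f) {x : V} (hx : x ∈ U) {I : Type*} (e : I → V)
    (S : Finset I) :
    (fun t : I → K => taylor K U f k x (∑ i ∈ S, t i • e i)) ∈ polyFun K W S k := by
  classical
  obtain ⟨a, ha⟩ := hf.exists_coeff_taylor hopen hdense hU hx e S
  have h : (fun t : I → K => taylor K U f k x (∑ i ∈ S, t i • e i)) =
      ∑ α ∈ (Finset.Icc 1 k).biUnion S.finsuppAntidiag, fun t => mon t α • a α := by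
    funext t
    rw [ha, Finset.sum_apply]
  rw [h]
  refine Submodule.sum_mem _ fun α hα => ?_
  obtain ⟨d, hd, hα⟩ := Finset.mem_biUnion.1 hα
  rw [mem_finsuppAntidiag_iff_degree] at hα
  exact mon_smul_mem_polyFun hα.2 (hα.1.trans_le (Finset.mem_Icc.1 hd).2) _

end Expansion

/-! ### Coordinates on the nilpotent part of the jet ring. -/

section JetRingCoordinates

variable {K : Type u} [CommRing K] {k : ℕ}

/-- The coefficient of `δ^j` (for `j ≤ k`) of an element of the jet ring. -/
noncomputable def jetCoeff (K : Type u) [CommRing K] (k j : ℕ) : JetRing K k →ₗ[K] K :=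
  (Polynomial.lcoeff K j).comp
    (AdjoinRoot.modByMonicHom (Polynomial.monic_X_pow (R := K) (k + 1)))

theorem jetCoeff_mk {j : ℕ} (hj : j ≤ k) (q : K[X]) :
    jetCoeff K k j (Ideal.Quotient.mk _ q) = q.coeff j := by
  have h1 : jetCoeff K k j (Ideal.Quotient.mk _ q) =
      (q %ₘ (Polynomial.X : K[X]) ^ (k + 1)).coeff j :=
    congrArg (fun r : K[X] => r.coeff j)
      (AdjoinRoot.modByMonicHom_mk (Polynomial.monic_X_pow (R := K) (k + 1)) q)
  have h2 := congrArg (fun r : K[X] => r.coeff j)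
    (Polynomial.modByMonic_add_div q ((Polynomial.X : K[X]) ^ (k + 1)))
  simp only [Polynomial.coeff_add, Polynomial.coeff_X_pow_mul'] at h2
  rw [if_neg (by omega), add_zero] at h2
  rw [h1, h2]

/-- The coefficient of `δ^(i+1)` of an element of the nilpotent part of the jet ring. -/
noncomputable def nilCoord (i : Fin k) : nilpotentPart K k →ₗ[K] K where
  toFun a := jetCoeff K k (i + 1) (a : JetRing K k)
  map_add' a b := map_add (jetCoeff K k (i + 1)) (a : JetRing K k) b
  map_smul' c a := map_smul (jetCoeff K k (i + 1)) c (a : JetRing K k)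

theorem nilCoord_of_coe_eq_mk {a : nilpotentPart K k} {q : K[X]}
    (h : (a : JetRing K k) = Ideal.Quotient.mk _ q) (i : Fin k) :
    nilCoord i a = q.coeff (i + 1) := by
  rw [← jetCoeff_mk (show (i : ℕ) + 1 ≤ k by omega) q, ← h]
  rfl

theorem nilCoord_deltaPow (i j : Fin k) :
    nilCoord i (deltaPow K k j) = if i = j then 1 else 0 := by
  rw [nilCoord_of_coe_eq_mk (q := Polynomial.X ^ ((j : ℕ) + 1)) (by rw [map_pow]; rfl) i,
    Polynomial.coeff_X_pow]
  simp [Fin.ext_iff]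

/-- The polynomial without constant term representing an element of the nilpotent part. -/
noncomputable def nilPoly (a : nilpotentPart K k) : K[X] :=
  ∑ i : Fin k, Polynomial.monomial ((i : ℕ) + 1) (nilCoord i a)

@[simp] theorem nilPoly_zero : nilPoly (0 : nilpotentPart K k) = 0 := by
  simp [nilPoly]

theorem coeff_nilPoly (a : nilpotentPart K k) (i : Fin k) :
    (nilPoly a).coeff (i + 1) = nilCoord i a := by
  simp [nilPoly, Polynomial.finsetSum_coeff, Polynomial.coeff_monomial, ← Fin.ext_iff]

theorem eval_nilPoly (a : nilpotentPart K k) (σ : K) :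
    (nilPoly a).eval σ = ∑ j ∈ Finset.range k, σ ^ (j + 1) * (nilPoly a).coeff (j + 1) := by
  rw [Finset.sum_range fun j => σ ^ (j + 1) * (nilPoly a).coeff (j + 1)]
  simp only [coeff_nilPoly]
  simp [nilPoly, Polynomial.eval_finsetSum, mul_comm]

theorem mk_nilPoly (a : nilpotentPart K k) :
    Ideal.Quotient.mk _ (nilPoly a) = (a : JetRing K k) := by
  obtain ⟨q, hq⟩ := Ideal.Quotient.mk_surjective (a : JetRing K k)
  have h0 : q.coeff 0 = 0 := by
    have h1 : JetRing.proj K k (a : JetRing K k) = 0 := a.2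
    rw [← hq] at h1
    have h2 : JetRing.proj K k (Ideal.Quotient.mk _ q) = Polynomial.aeval (0 : K) q := rfl
    rw [h2] at h1
    simpa [Polynomial.coeff_zero_eq_eval_zero] using h1
  rw [← hq, Ideal.Quotient.eq, Ideal.mem_span_singleton, Polynomial.X_pow_dvd_iff]
  intro d hd
  rw [Polynomial.coeff_sub]
  obtain _ | d := d
  · simp [h0, nilPoly, Polynomial.finsetSum_coeff, Polynomial.coeff_monomial]
  · rw [coeff_nilPoly a ⟨d, by omega⟩, nilCoord_of_coe_eq_mk hq.symm, sub_self]

theorem coe_deltaPow (i : ℕ) :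
    (deltaPow K k i : JetRing K k) = Ideal.Quotient.mk _ (Polynomial.X ^ (i + 1)) := by
  rw [map_pow]
  rfl

theorem sum_nilCoord_smul_deltaPow (a : nilpotentPart K k) :
    ∑ i, nilCoord i a • deltaPow K k i = a := by
  refine Subtype.ext ?_
  have h1 : ((∑ i, nilCoord i a • deltaPow K k i : nilpotentPart K k) : JetRing K k) =
      ∑ i, nilCoord i a • (deltaPow K k i : JetRing K k) := by
    rw [AddSubmonoidClass.coe_finsetSum]
    rfl
  rw [h1, ← mk_nilPoly a, nilPoly, map_sum]
  refine Finset.sum_congr rfl fun i _ => ?_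
  rw [coe_deltaPow, ← Polynomial.smul_X_eq_monomial]
  rfl

/-- The canonical map from the unitization to the jet ring is multiplicative. For `α ≠ 0` the scalar
part of the product is `0`, so this map sees only the component in the nilpotent part. -/
theorem coe_monomialValue {I : Type*} (c : I →₀ nilpotentPart K k) {α : I →₀ ℕ} (hα : α ≠ 0) :
    (monomialValue K (nilpotentPart K k) c α : JetRing K k) =
      Ideal.Quotient.mk _ (mon (fun i => nilPoly (c i)) α) := by
  set y : Unitization K (nilpotentPart K k) :=
    α.prod fun i n => (Unitization.inr (c i) : Unitization K (nilpotentPart K k)) ^ n with hy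
  set φ : Unitization K (nilpotentPart K k) →ₐ[K] JetRing K k :=
    Unitization.lift (NonUnitalSubalgebraClass.subtype (nilpotentPart K k))
  have h1 : φ y = Ideal.Quotient.mk _ (mon (fun i => nilPoly (c i)) α) := by
    rw [hy, mon, Finsupp.prod, Finsupp.prod, map_prod, map_prod]
    refine Finset.prod_congr rfl fun i _ => ?_
    rw [map_pow, map_pow, mk_nilPoly]
    simp [φ]
  have h2 : y.fst = 0 := by
    obtain ⟨i, hi⟩ := Finsupp.support_nonempty_iff.2 hα
    have : y.fst = Unitization.fstHom K (nilpotentPart K k) y := rfl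
    rw [this, hy, Finsupp.prod, map_prod]
    refine Finset.prod_eq_zero hi ?_
    rw [map_pow]
    simp [Finsupp.mem_support_iff.1 hi]
  have h3 : φ y = (y.snd : JetRing K k) := by
    rw [← Unitization.inl_fst_add_inr_snd_eq y, h2]
    simp [φ]
  rw [← h1, h3]
  rfl

theorem monomialValue_eq_sum {I : Type*} (c : I →₀ nilpotentPart K k) {α : I →₀ ℕ} (hα : α ≠ 0) :
    monomialValue K (nilpotentPart K k) c α =
      ∑ i : Fin k, (mon (fun i => nilPoly (c i)) α).coeff (i + 1) • deltaPow K k i := by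
  rw [← sum_nilCoord_smul_deltaPow (monomialValue K (nilpotentPart K k) c α)]
  refine Finset.sum_congr rfl fun i _ => ?_
  rw [nilCoord_of_coe_eq_mk (coe_monomialValue c hα)]

variable {V : Type v} [AddCommGroup V] [Module K V]

/-- The `δ^(i+1)`-coordinate of an element of `V ⊗ J^k_0 K`. -/
noncomputable def tensorCoord (i : Fin k) : V ⊗[K] nilpotentPart K k →ₗ[K] V :=
  (TensorProduct.rid K V).toLinearMap.comp (LinearMap.lTensor V (nilCoord i))

@[simp] theorem tensorCoord_tmul (i : Fin k) (y : V) (a : nilpotentPart K k) :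
    tensorCoord i (y ⊗ₜ[K] a) = nilCoord i a • y := by
  simp [tensorCoord]

theorem tensorCoord_nilpotentVector (y : Fin k → V) (i : Fin k) :
    tensorCoord i (nilpotentVector K k y) = y i := by
  simp [nilpotentVector, nilCoord_deltaPow]

end JetRingCoordinates

/-! ### Jets from Taylor polynomials; scalar extension. -/

section Jets

theorem isHomogeneousPolynomial_zero {K : Type u} [CommRing K] {V : Type v} [AddCommGroup V]
    [Module K V] {W : Type w} [AddCommGroup W] [Module K W] (d : ℕ) :
    IsHomogeneousPolynomial K d (0 : V → W) :=
  fun _ _ _ => ⟨0, fun _ => by simp⟩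

variable {K : Type u} [CommRing K] [TopologicalSpace K]

theorem jetAt_eq_extSeq {V : Type v} [AddCommGroup V] [Module K V] [TopologicalSpace V]
    {W : Type w} [AddCommGroup W] [Module K W] [TopologicalSpace W] (U : Set V) (f : V → W) {k : ℕ}
    {x : V} {y : ℕ → V} (h0 : y 0 = x) (z : Fin k → V) (hz : ∀ j : Fin k, y (j + 1) = z j)
    (l : Fin (k + 1)) : jetAt K U f k x z l = extSeq U f l y (0 : ℕ → K) := by
  have h : ∀ i : Fin (k + 1), (Fin.cons x z : Fin (k + 1) → V) i = y i := by
    intro i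
    refine Fin.cases ?_ (fun j => ?_) i
    · exact h0.symm
    · exact (hz j).symm
  unfold jetAt jet extSeq
  congr 2
  funext j
  exact h _

/-- Normalized differentials are the jet components at `(y, 0, …, 0)`, so no regularity is needed.
-/
theorem taylor_eq_of_jetAt_eq {V : Type v} [AddCommGroup V] [Module K V] [TopologicalSpace V]
    {W : Type w} [AddCommGroup W] [Module K W] [TopologicalSpace W] {k : ℕ} {U : Set V} {f g : V → W} {x : V}
    (h : jetAt K U f k x = jetAt K U g k x) : taylor K U f k x = taylor K U g k x := by
  funext y
  refine Finset.sum_congr rfl fun l hl => ?_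
  have hl' : l < k + 1 := Nat.lt_succ_of_le (Finset.mem_Icc.1 hl).2
  let s : ℕ → V := fun j => if j = 0 then x else if j = 1 then y else 0
  have h1 := congrFun (congrFun h fun j : Fin k => s (j + 1)) ⟨l, hl'⟩
  rwa [jetAt_eq_extSeq U f (x := x) (y := s) rfl _ fun _ => rfl,
    jetAt_eq_extSeq U g (x := x) (y := s) rfl _ fun _ => rfl] at h1

variable [IsTopologicalRing K]
variable {W : Type w} [AddCommGroup W] [Module K W] [TopologicalSpace W]
  [IsTopologicalAddGroup W] [ContinuousSMul K W] [T2Space W]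
variable {V : Type (max u v)} [AddCommGroup V] [Module K V] [TopologicalSpace V]
  [IsTopologicalAddGroup V] [ContinuousSMul K V]

/-- Both jets are the coefficients of the same function of `σ`, the common value at `x` plus the
common Taylor polynomial along the curve. -/
theorem jetAt_eq_of_taylor_eq (hopen : IsOpen {t : K | IsUnit t})
    (hdense : Dense {t : K | IsUnit t}) {k : ℕ} {U : Set V} (hU : IsOpen U) {f g : V → W}
    (hf : IsOfClass.{u, v, w} K k U f) (hg : IsOfClass.{u, v, w} K k U g) {x : V} (hx : x ∈ U)
    (hfg : f x = g x) (h : taylor K U f k x = taylor K U g k x) :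
    jetAt K U f k x = jetAt K U g k x := by
  funext z l
  let y : ℕ → V := fun j => if h : j < k + 1 then (Fin.cons x z : Fin (k + 1) → V) ⟨j, h⟩ else 0
  have h0 : y 0 = x := by simp [y]
  have hz : ∀ j : Fin k, y (j + 1) = z j := fun j => dif_pos (by omega)
  rw [jetAt_eq_extSeq U f h0 z hz, jetAt_eq_extSeq U g h0 z hz]
  have hy : y 0 ∈ U := by rwa [h0]
  refine eq_of_isFlat_sum_sub hdense (b := fun l => extSeq U f l y (0 : ℕ → K))
    (c := fun l => extSeq U g l y (0 : ℕ → K)) (((hf.isFlat_extSeq_sub_taylor hopen hdense hU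
      hy).sub (hg.isFlat_extSeq_sub_taylor hopen hdense hU hy)).congr'
      (Eventually.of_forall fun σ => ?_)) l (Nat.lt_succ_iff.1 l.2)
  rw [h0, h, hfg]
  abel

theorem IsOfClass.isPolynomialMap_taylor (hopen : IsOpen {t : K | IsUnit t})
    (hdense : Dense {t : K | IsUnit t}) {k : ℕ} {U : Set V} (hU : IsOpen U) {f : V → W}
    (hf : IsOfClass.{u, v, w} K k U f) {x : V} (hx : x ∈ U) :
    IsPolynomialMap K (taylor K U f k x) := by
  refine ⟨k, fun d => if 1 ≤ d ∧ d ≤ k then normalizedDifferential K U f d x else 0, fun d => ?_,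
    ?_⟩
  · dsimp only
    split_ifs with hd
    · exact hf.isHomogeneousPolynomial_normalizedDifferential hopen hdense hU hx hd.2
    · exact isHomogeneousPolynomial_zero d
  · funext y
    rw [Finset.sum_apply, sum_range_eq_add_sum_Icc]
    simp only [nonpos_iff_eq_zero, one_ne_zero, false_and, if_false, Pi.zero_apply, zero_add]
    exact Finset.sum_congr rfl fun l hl => by rw [if_pos (Finset.mem_Icc.1 hl)]

theorem IsOfClass.taylor_zero (hopen : IsOpen {t : K | IsUnit t})
    (hdense : Dense {t : K | IsUnit t}) {k : ℕ} {U : Set V} (hU : IsOpen U) {f : V → W}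
    (hf : IsOfClass.{u, v, w} K k U f) {x : V} (hx : x ∈ U) : taylor K U f k x 0 = 0 := by
  have h := hf.taylor_smul hopen hdense hU hx 0 0
  rw [smul_zero] at h
  rw [h]
  refine Finset.sum_eq_zero fun l hl => ?_
  rw [zero_pow (by have := (Finset.mem_Icc.1 hl).1; omega), zero_smul]

open Classical in
/-- The simplicial jet expressed through the coefficients of the Taylor polynomial. -/
theorem IsOfClass.extSeq_eq_sum_coeff (hopen : IsOpen {t : K | IsUnit t})
    (hdense : Dense {t : K | IsUnit t}) {k : ℕ} {U : Set V} (hU : IsOpen U) {f : V → W}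
    (hf : IsOfClass.{u, v, w} K k U f) {x : V} (hx : x ∈ U) {I : Type*} (e : I → V) {N : ℕ}
    {a : (I →₀ ℕ) → W} (ha : ∀ t : I →₀ K, taylor K U f k x (t.sum fun i r => r • e i) =
      ∑ d ∈ Finset.Icc 1 N, ∑ α ∈ t.support.finsuppAntidiag d, mon t α • a α)
    (c : I →₀ nilpotentPart K k) {y : ℕ → V} (h0 : y 0 = x)
    (hy : ∀ j < k, y (j + 1) = ∑ i ∈ c.support, (nilPoly (c i)).coeff (j + 1) • e i) {l : ℕ}
    (hl : 1 ≤ l) (hlk : l ≤ k) :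
    extSeq U f l y (0 : ℕ → K) = ∑ d ∈ Finset.Icc 1 N, ∑ α ∈ c.support.finsuppAntidiag d,
      (mon (fun i => nilPoly (c i)) α).coeff l • a α := by
  -- The curve is `∑ p_i(σ) e_i`, where `p_i` is the polynomial representing `c i`. The given
  -- expression of the Taylor polynomial then turns into a polynomial in `σ`, whose truncation
  -- yields the jet.
  have hcurve : ∀ σ : K, taylor K U f k x (∑ j ∈ Finset.range k, σ ^ (j + 1) • y (j + 1)) =
      ∑ d ∈ Finset.Icc 1 N, ∑ α ∈ c.support.finsuppAntidiag d,
        (mon (fun i => nilPoly (c i)) α).eval σ • a α := by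
    intro σ
    set t : I →₀ K := c.mapRange (fun b => (nilPoly b).eval σ) (by simp) with ht
    have hts : t.support ⊆ c.support := Finsupp.support_mapRange
    have h1 : ∑ j ∈ Finset.range k, σ ^ (j + 1) • y (j + 1) = t.sum fun i r => r • e i := by
      rw [Finsupp.sum_of_support_subset _ hts _ (by simp)]
      simp only [ht, Finsupp.mapRange_apply, eval_nilPoly, Finset.sum_smul, mul_smul]
      rw [Finset.sum_comm]
      exact Finset.sum_congr rfl fun j hj => by
        rw [hy j (Finset.mem_range.1 hj), Finset.smul_sum]
    rw [h1, ha]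
    refine Finset.sum_congr rfl fun d _ => ?_
    rw [sum_finsuppAntidiag_eq_of_subset hts d t fun i _ hi => Finsupp.notMem_support_iff.1 hi]
    refine Finset.sum_congr rfl fun α _ => ?_
    congr 1
    have h2 := map_finsuppProd (Polynomial.evalRingHom σ) α fun i n => nilPoly (c i) ^ n
    simp only [Polynomial.coe_evalRingHom, Polynomial.eval_pow] at h2
    exact h2.symm
  have hflat : IsFlat k fun σ : K => ∑ d ∈ Finset.Icc 1 N, ∑ α ∈ c.support.finsuppAntidiag d,
      ((mon (fun i => nilPoly (c i)) α).eval σ • a α - ∑ l ∈ Finset.range (k + 1),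
        σ ^ l • ((mon (fun i => nilPoly (c i)) α).coeff l • a α)) :=
    IsFlat.sum _ fun d _ => IsFlat.sum _ fun α _ => isFlat_eval_smul_sub k _ _
  have h1 := hf.isFlat_extSeq_sub_taylor hopen hdense hU (y := y) (by rwa [h0])
  have h2 := eq_of_isFlat_sum_sub hdense (b := fun l => extSeq U f l y (0 : ℕ → K))
    (c := fun l => (if l = 0 then f x else 0) + ∑ d ∈ Finset.Icc 1 N,
      ∑ α ∈ c.support.finsuppAntidiag d, (mon (fun i => nilPoly (c i)) α).coeff l • a α)
    ((h1.add hflat).congr' (Eventually.of_forall fun σ => ?_)) l hlk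
  · rw [h2, if_neg (by omega), zero_add]
  · rw [h0, hcurve]
    simp only [Finset.sum_sub_distrib, smul_add, Finset.sum_add_distrib, Finset.smul_sum]
    have h3 : ∑ l ∈ Finset.range (k + 1), σ ^ l • (if l = 0 then f x else 0) = f x := by
      rw [Finset.sum_eq_single 0] <;> simp +contextual
    have h4 : ∑ d ∈ Finset.Icc 1 N, ∑ α ∈ c.support.finsuppAntidiag d,
        ∑ l ∈ Finset.range (k + 1), σ ^ l • ((mon (fun i => nilPoly (c i)) α).coeff l • a α) =
        ∑ l ∈ Finset.range (k + 1), ∑ d ∈ Finset.Icc 1 N, ∑ α ∈ c.support.finsuppAntidiag d,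
          σ ^ l • ((mon (fun i => nilPoly (c i)) α).coeff l • a α) := by
      rw [Finset.sum_comm]
      exact Finset.sum_congr rfl fun d _ => Finset.sum_comm
    rw [h3, h4]
    abel

/-- The extension is the jet itself, transported by the coordinates in `δ, …, δ^k`. The jet of `∑
e_i ⊗ c_i` consists of the coefficients of `p^α` up to degree `k`, which are the coordinates of
`c^α`. -/
theorem IsOfClass.exists_isScalarExtension (hopen : IsOpen {t : K | IsUnit t})
    (hdense : Dense {t : K | IsUnit t}) {k : ℕ} {U : Set V} (hU : IsOpen U) {f : V → W}
    (hf : IsOfClass.{u, v, w} K k U f) {x : V} (hx : x ∈ U) :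
    ∃ Q : V ⊗[K] nilpotentPart K k → W ⊗[K] nilpotentPart K k,
      IsScalarExtension K (nilpotentPart K k) (taylor K U f k x) Q ∧
      ∀ y : Fin k → V, Q (nilpotentVector K k y) =
        nilpotentVector K k (Fin.tail (jetAt K U f k x y)) := by
  classical
  refine ⟨fun z => nilpotentVector K k (Fin.tail (jetAt K U f k x fun i => tensorCoord i z)),
    ⟨hf.isPolynomialMap_taylor hopen hdense hU hx, hf.taylor_zero hopen hdense hU hx, ?_⟩,
    fun y => by simp only [tensorCoord_nilpotentVector]⟩
  intro I e _ N a ha c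
  set y : ℕ → V := fun j => if j = 0 then x else
    ∑ i ∈ c.support, (nilPoly (c i)).coeff j • e i with hy
  have hz : ∀ j : Fin k, y (j + 1) = tensorCoord j (c.sum fun i r => e i ⊗ₜ[K] r) := by
    intro j
    rw [Finsupp.sum, map_sum]
    simp [hy, coeff_nilPoly]
  have hl : ∀ l : Fin k, Fin.tail (jetAt K U f k x fun i => tensorCoord i
      (c.sum fun i r => e i ⊗ₜ[K] r)) l = ∑ d ∈ Finset.Icc 1 N,
        ∑ α ∈ c.support.finsuppAntidiag d,
          (mon (fun i => nilPoly (c i)) α).coeff (l + 1) • a α := by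
    intro l
    rw [Fin.tail, jetAt_eq_extSeq U f (x := x) (y := y) rfl _ hz]
    exact hf.extSeq_eq_sum_coeff hopen hdense hU hx e ha c rfl (fun j _ => if_neg (by omega))
      (by simp) (by simp)
  dsimp only
  simp only [nilpotentVector, hl, TensorProduct.sum_tmul]
  rw [Finset.sum_comm]
  refine Finset.sum_congr rfl fun d hd => ?_
  rw [Finset.sum_comm]
  refine Finset.sum_congr rfl fun α hα => ?_
  have hα0 : α ≠ 0 := by
    rintro rfl
    have h1 := (mem_finsuppAntidiag_iff_degree.1 hα).1
    have h2 := (Finset.mem_Icc.1 hd).1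
    rw [map_zero] at h1
    omega
  rw [monomialValue_eq_sum c hα0, TensorProduct.tmul_sum]
  exact Finset.sum_congr rfl fun i _ => by rw [TensorProduct.smul_tmul]

end Jets

/-! ### Taylor polynomial of a composite. -/

section Composition

variable {K : Type u} [CommRing K] [TopologicalSpace K] [IsTopologicalRing K]
variable {W : Type w} [AddCommGroup W] [Module K W] [TopologicalSpace W]
  [IsTopologicalAddGroup W] [ContinuousSMul K W] [T2Space W]
variable {V : Type (max u v)} [AddCommGroup V] [Module K V] [TopologicalSpace V]
  [IsTopologicalAddGroup V] [ContinuousSMul K V]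

/-- Maps of class `C^[k]` with `k ≥ 1` preserve agreement of curves up to order `k`. -/
theorem IsOfClass.isFlat_comp_sub (hdense : Dense {t : K | IsUnit t}) {k : ℕ} {U : Set V}
    (hU : IsOpen U) {g : V → W} (hg : IsOfClass.{u, v, w} K (k + 1) U g) {y : V} (hy : y ∈ U)
    {c r : K → V} (hc : Tendsto c (𝓝[{t : K | IsUnit t}] 0) (𝓝 y)) (hr : IsFlat (k + 1) r) :
    IsFlat (k + 1) fun σ : K => g (c σ + r σ) - g (c σ) := by
  have := neBot_nhdsWithin_units hdense
  obtain ⟨hgc, G, hG, -⟩ := hg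
  have hmem : (y, (0 : V), (0 : K)) ∈ cubicDomain K U := by simpa [cubicDomain] using hy
  have hGc := hG.1.continuousAt ((isOpen_cubicDomain hU).mem_nhds hmem)
  have hG0 : G (y, 0, 0) = 0 := by
    have h1 : Tendsto (fun t : K => (y, (0 : V), t)) (𝓝[{t : K | IsUnit t}] 0)
        (𝓝 (y, 0, 0)) :=
      tendsto_const_nhds.prodMk_nhds (tendsto_const_nhds.prodMk_nhds tendsto_id_units)
    refine tendsto_nhds_unique (hGc.tendsto.comp h1)
      (Tendsto.congr' (eventually_isUnit.mono fun t ht => ?_) tendsto_const_nhds)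
    obtain ⟨t, rfl⟩ := ht
    have h2 := hG.2 y 0 t (by simpa [cubicDomain] using hy)
    simpa using h2.symm
  have hpow : Tendsto (fun σ : K => σ ^ (k + 1)) (𝓝[{t : K | IsUnit t}] 0) (𝓝 0) := by
    simpa using (tendsto_id_units (K := K)).pow (k + 1)
  -- The increment `r σ` is written as step `σ^(k+1)` times direction `σ^(-(k+1)) r σ`. Both tend to
  -- `0`, so the difference quotient tends to `G (y, 0, 0) = 0`.
  have hcurve := hc.prodMk_nhds (hr.prodMk_nhds hpow)
  have hlim := hGc.tendsto.comp hcurve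
  rw [hG0] at hlim
  refine (isFlat_pow_smul (k := k + 1) hlim).congr' ?_
  filter_upwards [hcurve ((isOpen_cubicDomain hU).mem_nhds hmem), eventually_isUnit] with σ h1 hσ
  have h2 := hG.add_smul hdense hU hgc h1
  rw [smul_smul, ← mul_pow, Ring.mul_inverse_cancel _ hσ, one_pow, one_smul] at h2
  rw [h2, add_sub_cancel_left]
  rfl

variable {V' : Type (max u v')} [AddCommGroup V'] [Module K V'] [TopologicalSpace V']
  [IsTopologicalAddGroup V'] [ContinuousSMul K V'] [T2Space V]

/-- Replace `h (x + σ y)` by its Taylor expansion inside `g`, at the cost of `o(σ^k)`, and expand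
`g`. Sorting the result into homogeneous components gives an expansion of `g ∘ h`, to be compared
with its own. -/
theorem IsOfClass.isTruncation_taylor_comp [T2Space K] (hopen : IsOpen {t : K | IsUnit t})
    (hdense : Dense {t : K | IsUnit t}) {k : ℕ} {U : Set V} (hU : IsOpen U) {U' : Set V'}
    (hU' : IsOpen U') {g : V → W} {h : V' → V} (hg : IsOfClass.{u, v, w} K k U g)
    (hh : IsOfClass.{u, v', max u v} K k U' h) (hmaps : Set.MapsTo h U' U) {x : V'}
    (hx : x ∈ U') :
    IsTruncation K k (taylor K U g k (h x) ∘ taylor K U' h k x) (taylor K U' (g ∘ h) k x) := by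
  classical
  have hgh : IsOfClass.{u, v', w} K k U' (g ∘ h) := hg.comp hdense hU' hh hmaps
  obtain _ | k := k
  · refine ⟨0, 0, fun d => isHomogeneousPolynomial_zero d, ?_, ?_⟩ <;>
    · funext y
      simp [taylor]
  have hC : ∀ (I : Type (max u v')) (e : I → V') (S : Finset I),
      (fun t : I → K => (taylor K U g (k + 1) (h x) ∘ taylor K U' h (k + 1) x)
        (∑ i ∈ S, t i • e i)) ∈ polyFun K W S ((k + 1) * (k + 1)) := by
    intro I e S
    obtain ⟨b, hb⟩ := hh.exists_coeff_taylor hopen hdense hU' hx e S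
    simp only [Function.comp_apply, hb]
    refine comp_mon_mem_polyFun (b := fun α => α)
      (T := (Finset.Icc 1 (k + 1)).biUnion S.finsuppAntidiag) ?_ ?_
      (hg.taylor_mem_polyFun hopen hdense hU (hmaps hx) b _)
    · intro α hα
      obtain ⟨d, _, hα⟩ := Finset.mem_biUnion.1 hα
      exact (mem_finsuppAntidiag_iff_degree.1 hα).2
    · intro α hα
      obtain ⟨d, hd, hα⟩ := Finset.mem_biUnion.1 hα
      exact (mem_finsuppAntidiag_iff_degree.1 hα).1.trans_le (Finset.mem_Icc.1 hd).2
  obtain ⟨p, hp, hsum, hpσ⟩ := exists_homogeneous_components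
    (fun n => (dense_nonsingular hopen hdense n).nonempty) hC
  have hN : k + 1 ≤ (k + 1) * (k + 1) := Nat.le_mul_self _
  refine ⟨(k + 1) * (k + 1), p, hp, hsum, ?_⟩
  have hfilter : (Finset.range ((k + 1) * (k + 1) + 1)).filter (fun d => d ≤ k + 1) =
      Finset.range (k + 1 + 1) := by
    ext d
    simp only [Finset.mem_filter, Finset.mem_range]
    omega
  rw [hfilter]
  funext y
  -- Chosen so that `σ • c σ` is the Taylor polynomial of `h` at `σ • y`, with `c` continuous at `0`
  -- as the expansion of `g` requires.
  set c : K → V := fun σ => ∑ j ∈ Finset.range (k + 1),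
    σ ^ j • normalizedDifferential K U' h (j + 1) x y with hcdef
  have hc : Continuous c := by fun_prop
  have hσc : ∀ σ : K, σ • c σ = taylor K U' h (k + 1) x (σ • y) := by
    intro σ
    have h1 := sum_range_eq_add_sum_Icc
      (fun l => σ ^ l • normalizedDifferential K U' h l x y) (k + 1)
    rw [Finset.sum_range_succ', add_comm, add_right_inj] at h1
    · rw [hh.taylor_smul hopen hdense hU' hx, ← h1, hcdef, Finset.smul_sum]
      exact Finset.sum_congr rfl fun j _ => by rw [smul_smul, pow_succ']
  have hc0 : Tendsto c (𝓝[{t : K | IsUnit t}] 0) (𝓝 (c 0)) :=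
    (hc.tendsto 0).mono_left nhdsWithin_le_nhds
  have h1 := hg.isFlat_sub_taylor hopen hdense hU (hmaps hx) hc0
  have h2 := hg.isFlat_comp_sub hdense hU (hmaps hx) (tendsto_add_smul (h x) hc0)
    (hh.isFlat_sub_taylor hopen hdense hU' hx (tendsto_const_nhds (x := y)))
  have h3 := hgh.isFlat_sub_normalizedDifferential hopen hdense hU' hx
    (tendsto_const_nhds (x := y))
  have h4 : IsFlat (k + 1) fun σ : K =>
      ∑ d ∈ Finset.Ico (k + 1 + 1) ((k + 1) * (k + 1) + 1), σ ^ d • p d y := by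
    refine IsFlat.sum _ fun d hd => ?_
    refine (isFlat_eval_smul_sub (k + 1) (Polynomial.X ^ d) (p d y)).congr'
      (Eventually.of_forall fun σ => ?_)
    rw [Finset.sum_eq_zero, sub_zero, Polynomial.eval_pow, Polynomial.eval_X]
    intro l hl
    have : l ≠ d := by
      have h5 := (Finset.mem_Ico.1 hd).1
      have h6 := Finset.mem_range.1 hl
      omega
    rw [Polynomial.coeff_X_pow, if_neg this, zero_smul, smul_zero]
  have key := eq_of_isFlat_sum_sub hdense (k := k + 1)
    (b := fun l => normalizedDifferential K U' (g ∘ h) l x y)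
    (c := fun l => (if l = 0 then g (h x) else 0) + p l y)
    ((((h1.add h2).add h4).sub h3).congr' (Eventually.of_forall fun σ => ?_))
  -- At index `0` both expansions contain `g (h x)`, so the composed polynomial has no constant term
  -- and the sum may start at degree `1`.
  · have hp0 : p 0 y = 0 := by
      have h5 := key 0 (Nat.zero_le _)
      rw [if_pos rfl, normalizedDifferential_zero hgh hx] at h5
      simpa using h5
    rw [Finset.sum_apply, sum_range_eq_add_sum_Icc (fun d => p d y), hp0, zero_add]
    refine Finset.sum_congr rfl fun l hl => ?_
    have hl' := Finset.mem_Icc.1 hl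
    rw [key l hl'.2, if_neg (by omega), zero_add]
  · have h5 : taylor K U g (k + 1) (h x) (taylor K U' h (k + 1) x (σ • y)) =
        ∑ d ∈ Finset.range (k + 1 + 1), σ ^ d • p d y +
          ∑ d ∈ Finset.Ico (k + 1 + 1) ((k + 1) * (k + 1) + 1), σ ^ d • p d y := by
      have h6 := congrFun hsum (σ • y)
      rw [Finset.sum_apply, Finset.sum_congr rfl fun d _ => hpσ d σ y] at h6
      rw [Finset.sum_range_add_sum_Ico _ (by omega)]
      exact h6
    have h7 : ∑ l ∈ Finset.range (k + 1 + 1), σ ^ l • (if l = 0 then g (h x) else 0) =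
        g (h x) := by
      rw [Finset.sum_eq_single 0] <;> simp +contextual
    rw [hσc, h5, add_sub_cancel]
    simp only [smul_add, Finset.sum_add_distrib, h7, Function.comp_apply]
    abel

end Composition

end WeilJet

theorem theorem2
    {K : Type u} [CommRing K] [TopologicalSpace K] [IsTopologicalRing K] [T2Space K]
    (hopen : IsOpen {t : K | IsUnit t}) (hdense : Dense {t : K | IsUnit t})
    (hinv : ContinuousOn Ring.inverse {t : K | IsUnit t})
    {V : Type (max u v)} [AddCommGroup V] [Module K V] [TopologicalSpace V]
    [IsTopologicalAddGroup V] [ContinuousSMul K V] [T2Space V]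
    {V' : Type (max u v')} [AddCommGroup V'] [Module K V'] [TopologicalSpace V']
    [IsTopologicalAddGroup V'] [ContinuousSMul K V']
    {W : Type w} [AddCommGroup W] [Module K W] [TopologicalSpace W]
    [IsTopologicalAddGroup W] [ContinuousSMul K W] [T2Space W]
    (k : ℕ) (U : Set V) (hU : IsOpen U) (U' : Set V') (hU' : IsOpen U')
    (f g : V → W) (h : V' → V)
    (hf : WeilJet.IsOfClass.{u, v, w} K k U f)
    (hg : WeilJet.IsOfClass.{u, v, w} K k U g)
    (hh : WeilJet.IsOfClass.{u, v', max u v} K k U' h)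
    (hmaps : Set.MapsTo h U' U) :
    (∀ x ∈ U, f x = g x →
      (WeilJet.taylor K U f k x = WeilJet.taylor K U g k x ↔
        WeilJet.jetAt K U f k x = WeilJet.jetAt K U g k x)) ∧
    (∀ x ∈ U, ∃ Q : V ⊗[K] WeilJet.nilpotentPart K k → W ⊗[K] WeilJet.nilpotentPart K k,
      WeilJet.IsScalarExtension K (WeilJet.nilpotentPart K k) (WeilJet.taylor K U f k x) Q ∧
      ∀ v : Fin k → V, Q (WeilJet.nilpotentVector K k v) =
        WeilJet.nilpotentVector K k (Fin.tail (WeilJet.jetAt K U f k x v))) ∧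
    (WeilJet.IsOfClass.{u, v', w} K k U' (g ∘ h) ∧
      ∀ x ∈ U', WeilJet.IsTruncation K k
        (WeilJet.taylor K U g k (h x) ∘ WeilJet.taylor K U' h k x)
        (WeilJet.taylor K U' (g ∘ h) k x)) := by
  refine ⟨fun x hx hfg => ⟨fun htay => ?_, fun hjet => ?_⟩, fun x hx => ?_, ?_, fun x hx => ?_⟩
  · exact WeilJet.jetAt_eq_of_taylor_eq hopen hdense hU hf hg hx hfg htay
  · exact WeilJet.taylor_eq_of_jetAt_eq hjet
  · exact hf.exists_isScalarExtension hopen hdense hU hx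
  · exact hg.comp hdense hU' hh hmaps
  · exact hg.isTruncation_taylor_comp hopen hdense hU hU' hh hmaps hx
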